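/- Let $d\ge 1$, let $\{|a_i\rangle\}_{i=1}^d$, $\{|b_i\rangle\}_{i=1}^d$ be orthonormal bases of $\mathbb C^d$ (systems $A$ and $B$), and let $\rho_{\rm mc}=\sum_{i,j}\rho_{ij}\,|a_ib_i\rangle\langle a_jb_j|$ be a density matrix (a maximally correlated state). Fix an orthonormal basis $\{|i\rangle\}_{i=1}^d$ of $\mathbb C^d$, let $\widetilde{\rho}_{\rm mc}=\sum_{i,j}\rho_{ij}\,|i\rangle\langle j|$ be the corresponding single-party state, let $\mathcal I=\mathrm{conv}\{|i\rangle\langle i|\}_i$ be the set of incoherent (diagonal) states, and let $\Delta(X)=\sum_i |i\rangle\langle i|X|i\rangle\langle i|$. Write $\langle X,Y\rangle=\mathrm{Tr}(X^\dagger Y)$, let $X^{T_B}$ be the partial transpose, and let $\Psi_m$ be the projector onto $\frac1{\sqrt m}\sum_{i=1}^m|ii\rangle$. Let $\mathcal O$ be any one of the following four classes of completely positive trace-preserving maps $\Lambda:AB\to A'B'$: PPT operations (the Choi matrix satisfies $J_\Lambda^{T_{BB'}}\succeq 0$); Rains-preserving operations ($\Lambda$ maps $\{X\succeq0:\|X^{T_B}\|_1\le1\}$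 into the corresponding set of $A'B'$); ${\rm PPT}_+$-preserving operations ($\Lambda$ maps $\{X\succeq 0:\mathrm{Tr}X=1,\ X^{T_B}\succeq0\}$ into the corresponding set of $A'B'$); SEPP, the separability-preserving operations ($\Lambda$ maps separable states to separable states). Put $$F_{\mathcal O}(\rho,m)=\sup\{\langle\Lambda(\rho),\Psi_m\rangle:\Lambda\in\mathcal O,\ d_{A'}=d_{B'}=m\},$$ $$G^{(m)}_{\mathcal I}(\rho)=\sup\{\langle\rho,W\rangle:0\preceq W\preceq \mathbb 1,\ W\in\tfrac1m\mathcal I^\circ\},$$ where $\mathcal I^\circ=\{X \text{ Hermitian}:\langle X,Q\rangle\le1\ \ \forall Q\in\mathcal I\}$. Then for every integer $m\ge1$ $$F_{\mathcal O}(\rho_{\rm mc},m)=G^{(m)}_{\mathcal I}(\widetilde\rho_{\rm mc}).$$ Consequently, for every $0\le\varepsilon\le1$, the one-shot distillable entanglement $E^{(1),\varepsilon}_{d,\mathcal O}(\rho)=\log_2\max\{m\ge1:F_{\mathcal O}(\rho,m)\ge1-\varepsilon\}$ (read as $+\infty$ if there is no largest such $m$) satisfies $$E^{(1),\varepsilon}_{d,\mathcal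 O}(\rho_{\rm mc})=\Big\lfloor\min_{\sigma\in\mathcal I}D_H^\varepsilon(\widetilde\rho_{\rm mc}\|\sigma)\Big\rfloor_{\log}=\Big\lfloor-\log_2\min_{\substack{0\preceq W\preceq\mathbb 1\\ \langle\widetilde\rho_{\rm mc},W\rangle\ge1-\varepsilon}}\|\Delta(W)\|_\infty\Big\rfloor_{\log},$$ all minima being attained, where $D_H^\varepsilon(\rho\|X)=-\log_2\min\{\langle M,X\rangle:0\preceq M\preceq\mathbb 1,\ 1-\langle M,\rho\rangle\le\varepsilon\}$, $\lfloor x\rfloor_{\log}=\log_2\lfloor2^x\rfloor$, and $\log_2 0=-\infty$. The last minimum is the value of the semidefinite program of minimising $t\in\mathbb R$ subject to $0\preceq W\preceq\mathbb 1$, $\langle\widetilde\rho_{\rm mc},W\rangle\ge1-\varepsilon$ and $\Delta(W)\preceq t\,\mathbb 1$. -/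

import Mathlib

open scoped Pointwise ComplexOrder

noncomputable section

namespace Distill

/-! ### Linear algebra on finite-dimensional Hilbert spaces

The Hilbert space with computational basis indexed by `n` is `EuclideanSpace ℂ n`, operators on it
are `Matrix n n ℂ`, and a bipartite system `AB` is indexed by `α × β`. -/

section LinearAlgebra

variable {n α β : Type*} [Fintype n] [DecidableEq n]
  [Fintype α] [DecidableEq α] [Fintype β] [DecidableEq β]

/-- The operator `|x⟩⟨y|`. -/
def ketbra (x y : EuclideanSpace ℂ n) : Matrix n n ℂ :=
  Matrix.of fun i j => x i * star (y j)

/-- The product vector `|x⟩ ⊗ |y⟩`. -/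
def tensorKet (x : EuclideanSpace ℂ α) (y : EuclideanSpace ℂ β) : EuclideanSpace ℂ (α × β) :=
  WithLp.toLp 2 fun p => x p.1 * y p.2

/-- The Hilbert–Schmidt inner product `⟨X, Y⟩ = Tr (X† Y)`, which is real for Hermitian `X, Y`. -/
def hs (X Y : Matrix n n ℂ) : ℝ := (X.conjTranspose * Y).trace.re

/-- The trace norm `‖X‖₁ = Tr |X|`. -/
def traceNorm (X : Matrix n n ℂ) : ℝ :=
  open scoped MatrixOrder in (CFC.abs X).trace.re

/-- The operator norm `‖X‖_∞` (on the Euclidean space). -/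
def opNorm (X : Matrix n n ℂ) : ℝ := ‖Matrix.toEuclideanCLM (n := n) (𝕜 := ℂ) X‖

/-- Density matrices. -/
def IsState (ρ : Matrix n n ℂ) : Prop := ρ.PosSemidef ∧ ρ.trace = 1

/-- The operator inequality `0 ⪯ W ⪯ 𝟙`. -/
def IsEffect (W : Matrix n n ℂ) : Prop := W.PosSemidef ∧ (1 - W).PosSemidef

/-- The partial transpose `X ↦ X^{T_B}` on the second tensor factor (computational basis). -/
def partialTranspose (X : Matrix (α × β) (α × β) ℂ) : Matrix (α × β) (α × β) ℂ :=
  Matrix.of fun p q => X (p.1, q.2) (q.1, p.2)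

/-- The polar `Q° = {X Hermitian | ⟨X, Y⟩ ≤ 1 for all Y ∈ Q}`. -/
def polar (Q : Set (Matrix n n ℂ)) : Set (Matrix n n ℂ) :=
  {X | X.IsHermitian ∧ ∀ Y ∈ Q, hs X Y ≤ 1}

/-! ### Sets of operators -/

/-- Separable states: the convex hull of the pure product states. -/
def SEP : Set (Matrix (α × β) (α × β) ℂ) :=
  convexHull ℝ {X | ∃ (x : EuclideanSpace ℂ α) (y : EuclideanSpace ℂ β),
    ‖x‖ = 1 ∧ ‖y‖ = 1 ∧ X = ketbra (tensorKet x y) (tensorKet x y)}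

/-- States with positive partial transpose. -/
def PPTplus : Set (Matrix (α × β) (α × β) ℂ) :=
  {X | X.trace = 1 ∧ X.PosSemidef ∧ (partialTranspose X).PosSemidef}

/-- The Rains set. -/
def Rains : Set (Matrix (α × β) (α × β) ℂ) :=
  {X | X.PosSemidef ∧ traceNorm (partialTranspose X) ≤ 1}

/-- The incoherent states with respect to an orthonormal basis `c`. -/
def incoherent (c : OrthonormalBasis n ℂ (EuclideanSpace ℂ n)) : Set (Matrix n n ℂ) :=
  convexHull ℝ (Set.range fun i => ketbra (c i) (c i))

/-- The completely dephasing map `Δ(X) = ∑ᵢ |cᵢ⟩⟨cᵢ| X |cᵢ⟩⟨cᵢ|` in the basis `c`. -/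
def dephase (c : OrthonormalBasis n ℂ (EuclideanSpace ℂ n)) (X : Matrix n n ℂ) :
    Matrix n n ℂ :=
  ∑ i, ketbra (c i) (c i) * X * ketbra (c i) (c i)

/-- `∑ᵢⱼ rᵢⱼ |aᵢ bᵢ⟩⟨aⱼ bⱼ|` for local orthonormal bases `a` and `b`. -/
def maxCorr (a b : OrthonormalBasis n ℂ (EuclideanSpace ℂ n)) (r : Matrix n n ℂ) :
    Matrix (n × n) (n × n) ℂ :=
  ∑ i, ∑ j, r i j • ketbra (tensorKet (a i) (b i)) (tensorKet (a j) (b j))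

/-- `∑ᵢⱼ rᵢⱼ |cᵢ⟩⟨cⱼ|` for an orthonormal basis `c`. -/
def singleParty (c : OrthonormalBasis n ℂ (EuclideanSpace ℂ n)) (r : Matrix n n ℂ) :
    Matrix n n ℂ :=
  ∑ i, ∑ j, r i j • ketbra (c i) (c j)

end LinearAlgebra

/-! ### Quantum channels and classes of channels -/

section Channels

/-- Linear maps from operators on the space indexed by `ι` to operators on the one indexed
by `κ`. -/
abbrev OpMap (ι κ : Type*) := Matrix ι ι ℂ →ₗ[ℂ] Matrix κ κ ℂ

variable {ι κ : Type*} [Fintype ι] [Fintype κ]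

/-- The map `Λ ⊗ id` where `id` acts on operators on `ℂᵏ`. -/
def ampliation (Λ : OpMap ι κ) (k : ℕ) (X : Matrix (ι × Fin k) (ι × Fin k) ℂ) :
    Matrix (κ × Fin k) (κ × Fin k) ℂ :=
  Matrix.of fun p q => Λ (Matrix.of fun i j => X (i, p.2) (j, q.2)) p.1 q.1

/-- Completely positive and trace preserving maps. -/
def IsCPTP (Λ : OpMap ι κ) : Prop :=
  (∀ (k : ℕ) (X : Matrix (ι × Fin k) (ι × Fin k) ℂ),
    X.PosSemidef → (ampliation Λ k X).PosSemidef) ∧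
  ∀ X, (Λ X).trace = X.trace

variable {α β α' β' : Type*} [Fintype α] [DecidableEq α] [Fintype β] [DecidableEq β]
  [Fintype α'] [DecidableEq α'] [Fintype β'] [DecidableEq β']

/-- The Choi matrix `∑ |x⟩⟨y| ⊗ Λ(|x⟩⟨y|)` of `Λ : AB → A'B'`, with the tensor factors arranged
along the bipartition `AA' | BB'`. -/
def choi (Λ : OpMap (α × β) (α' × β')) :
    Matrix ((α × α') × (β × β')) ((α × α') × (β × β')) ℂ :=
  Matrix.of fun p q =>
    Λ (Matrix.single (p.1.1, p.2.1) (q.1.1, q.2.1) 1) (p.1.2, p.2.2) (q.1.2, q.2.2)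

/-- The four classes of operations under consideration. -/
inductive OpClass
  | PPT
  | RainsPreserving
  | PPTplusPreserving
  | SEPP

/-- The channels `Λ : AB → A'B'` in a given class. -/
def OpClass.channels (O : OpClass) : Set (OpMap (α × β) (α' × β')) :=
  match O with
  | .PPT => {Λ | IsCPTP Λ ∧ (partialTranspose (choi Λ)).PosSemidef}
  | .RainsPreserving => {Λ | IsCPTP Λ ∧ ∀ X ∈ Rains, Λ X ∈ Rains}
  | .PPTplusPreserving => {Λ | IsCPTP Λ ∧ ∀ X ∈ PPTplus, Λ X ∈ PPTplus}
  | .SEPP => {Λ | IsCPTP Λ ∧ ∀ X ∈ SEP, Λ X ∈ SEP}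

end Channels

/-! ### Operational quantities

All optimal values live in the extended reals, so that every supremum and infimum has its usual
meaning (with `sup ∅ = -∞` and `inf ∅ = +∞`). -/

section Quantities

/-- Base-2 logarithm on the extended reals, with `log x = -∞` for `x ≤ 0`. -/
def elog (x : EReal) : EReal :=
  if x ≤ 0 then ⊥ else if x = ⊤ then ⊤ else ((Real.logb 2 x.toReal : ℝ) : EReal)

/-- `⌊x⌋_log = log ⌊2 ^ x⌋`, with `2 ^ (-∞) = 0` and `2 ^ (+∞) = +∞`. -/
def logFloor (x : EReal) : EReal :=
  if x = ⊥ then ⊥ else if x = ⊤ then ⊤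
  else elog (((⌊(2 : ℝ) ^ x.toReal⌋ : ℝ)) : EReal)

variable {n α β : Type*} [Fintype n] [DecidableEq n]
  [Fintype α] [DecidableEq α] [Fintype β] [DecidableEq β]

/-- `G^{(m)}_Q(ρ) = sup {⟨ρ, W⟩ | 0 ⪯ W ⪯ 𝟙, W ∈ (1/m) Q°}`. -/
def G (m : ℝ) (Q : Set (Matrix n n ℂ)) (ρ : Matrix n n ℂ) : EReal :=
  ⨆ W ∈ {W : Matrix n n ℂ | IsEffect W ∧ W ∈ (1 / m) • polar Q}, ((hs ρ W : ℝ) : EReal)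

/-- The vector `|Ψ_m⟩ = ∑ᵢ |ii⟩ / √m`. -/
def maxEntKet (m : ℕ) : EuclideanSpace ℂ (Fin m × Fin m) :=
  ∑ i : Fin m, (1 / (Real.sqrt m : ℂ)) •
    tensorKet (EuclideanSpace.single i (1 : ℂ)) (EuclideanSpace.single i (1 : ℂ))

/-- The maximally entangled state `Ψ_m`. -/
def maxEnt (m : ℕ) : Matrix (Fin m × Fin m) (Fin m × Fin m) ℂ :=
  ketbra (maxEntKet m) (maxEntKet m)

/-- The fidelity of distillation `F_O(ρ, m)`: the supremum of `⟨Λ(ρ), Ψ_m⟩` over all `Λ ∈ O`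
with output system `ℂᵐ ⊗ ℂᵐ`. -/
def fidelity (O : OpClass) (ρ : Matrix (α × β) (α × β) ℂ) (m : ℕ) : EReal :=
  ⨆ Λ ∈ (O.channels : Set (OpMap (α × β) (Fin m × Fin m))), ((hs (Λ ρ) (maxEnt m) : ℝ) : EReal)

/-- The one-shot `ε`-error distillable entanglement
`log max {m ≥ 1 | F_O(ρ, m) ≥ 1 - ε}` (`+∞` if there is no largest such `m`). -/
def distillable (O : OpClass) (ε : ℝ) (ρ : Matrix (α × β) (α × β) ℂ) : EReal :=
  ⨆ m ∈ {m : ℕ | 1 ≤ m ∧ ((1 - ε : ℝ) : EReal) ≤ fidelity O ρ m}, elog ((m : ℝ) : EReal)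

/-- The hypothesis testing relative entropy
`D_H^ε(ρ‖X) = -log min {⟨M, X⟩ | 0 ⪯ M ⪯ 𝟙, 1 - ⟨M, ρ⟩ ≤ ε}`. -/
def DH (ε : ℝ) (ρ X : Matrix n n ℂ) : EReal :=
  -elog (⨅ M ∈ {M : Matrix n n ℂ | IsEffect M ∧ 1 - hs M ρ ≤ ε}, ((hs M X : ℝ) : EReal))

end Quantities

end Distill

end

namespace Distill

set_option linter.unusedSectionVars false

/-! ### Positivity of finite matrices, weighted swaps and the trace norm. -/

section Matrices

open Matrix
open scoped Kronecker

variable {ι κ : Type*} [Fintype ι] [Fintype κ]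

/-! Everything is reduced to the coefficient matrix `r`. With the isometry `V : |i⟩ ↦ |aᵢbᵢ⟩` and
the unitary `U` of the basis `c`, the two states are `V r V†` and `U r U†`, and both sides of the
fidelity identity equal the supremum of `Tr (r A)` over effects `A` with all diagonal entries at
most `1/m` (`fidelity_maxCorr`, `G_incoherent_singleParty`).

Converse: pull `Ψ_m` back through `X ↦ Λ (V X V†)` to get an effect `A`. Its entry `Aᵢᵢ` is the
overlap of `Λ(|aᵢbᵢ⟩⟨aᵢbᵢ|)` with `Ψ_m`. Each of the four classes sends separable states into the
Rains set (`OpClass.map_mem_Rains`), where this overlap is at most `1/m`, because the partial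
transpose of `Ψ_m` is the flip divided by `m` (`hs_maxEnt_le_of_mem_Rains`).

Achievability: given such an `A`, positivity bounds every entry by `1/m`, not just the diagonal
ones. The partial transpose of `M = V A V†` is unitarily equivalent to a swap weighted by the
entries of `A`, so it lies between `-1/m` and `1/m`. Measure `M` and prepare `Ψ_m` on success. On
failure, the normalised complement of `Ψ_m` gives a PPT operation, which also settles the
Rains-preserving and PPT₊-preserving classes; the normalised projector onto `span {|ij⟩ | i ≠ j}`
gives a separability-preserving one.

One-shot formula: let `w` be the least possible largest diagonal entry among effects accepting `r`
with probability at least `1 - ε`. Compactness makes `m` achievable exactly when `w ≤ 1/m`, that is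
`m ≤ ⌊1/w⌋`. Sion's theorem on accepting effects against probability vectors identifies `w` with the
hypothesis-testing value minimised over incoherent states (`exists_saddlePoint_acceptingEffects`),
and dephasing reads `w` off as an operator norm or as the semidefinite program. -/

theorem trace_mul_nonneg {A B : Matrix ι ι ℂ} (hA : A.PosSemidef) (hB : B.PosSemidef) :
    0 ≤ (A * B).trace := by
  classical
  open scoped MatrixOrder in
  obtain ⟨K, rfl⟩ := CStarAlgebra.nonneg_iff_eq_star_mul_self.mp hA.nonneg
  rw [star_eq_conjTranspose, Matrix.mul_assoc, Matrix.trace_mul_comm]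
  exact (hB.mul_mul_conjTranspose_same K).trace_nonneg

theorem trace_mul_nonneg_re {A B : Matrix ι ι ℂ} (hA : A.PosSemidef) (hB : B.PosSemidef) :
    0 ≤ (A * B).trace.re :=
  (Complex.le_def.mp (trace_mul_nonneg hA hB)).1

/-- Contracting a positive semidefinite matrix with the first factor of another one. -/
theorem posSemidef_contract {Y : Matrix ι ι ℂ} {J : Matrix (ι × κ) (ι × κ) ℂ}
    (hY : Y.PosSemidef) (hJ : J.PosSemidef) :
    (Matrix.of fun u v : κ => ∑ x, ∑ y, Y x y * J (x, u) (y, v)).PosSemidef := by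
  classical
  -- Schur product theorem: inflate `Y` along the first projection, multiply entrywise by `J`, then
  -- compress by the matrix that sums over the first index.
  have h := ((hY.submatrix (Prod.fst : ι × κ → ι)).hadamard hJ).conjTranspose_mul_mul_same
    (Matrix.of fun (p : ι × κ) (u : κ) => if p.2 = u then (1 : ℂ) else 0)
  convert! h using 1
  ext u v
  simp only [Matrix.of_apply, Matrix.mul_apply, Matrix.conjTranspose_apply, Fintype.sum_prod_type,
    Matrix.hadamard_apply, Matrix.submatrix_apply, apply_ite star, star_one, star_zero, ite_mul,
    one_mul, zero_mul, mul_ite, mul_one, mul_zero, Finset.sum_ite_eq', Finset.mem_univ, if_true]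
  rw [Finset.sum_comm]

theorem hs_eq_of_isHermitian [DecidableEq ι] {X : Matrix ι ι ℂ} (hX : X.IsHermitian)
    (Y : Matrix ι ι ℂ) : hs X Y = (X * Y).trace.re := by
  rw [hs, hX.eq]

omit [Fintype ι] in
-- The principal minor on `{i, j}` gives `|Wᵢⱼ|² ≤ Wᵢᵢ Wⱼⱼ ≤ t²`. This turns a constraint on the
-- diagonal into a bound on all entries.
theorem norm_apply_le_of_diag_le {W : Matrix ι ι ℂ} (hW : W.PosSemidef) {t : ℝ} (ht : 0 ≤ t)
    (hd : ∀ i, (W i i).re ≤ t) (i j : ι) : ‖W i j‖ ≤ t := by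
  have h := (hW.submatrix ![i, j]).det_nonneg
  have hji : W j i = star (W i j) := by rw [← Matrix.conjTranspose_apply, hW.1.eq]
  have hi := Complex.le_def.mp (hW.diag_nonneg (i := i))
  have hj := Complex.le_def.mp (hW.diag_nonneg (i := j))
  rw [Matrix.det_fin_two] at h
  simp only [Matrix.submatrix_apply, Matrix.cons_val_zero, Matrix.cons_val_one, hji] at h
  have h1 := (Complex.le_def.mp h).1
  have h2 : (W i j * star (W i j)).re = ‖W i j‖ ^ 2 := by
    rw [Complex.star_def, Complex.mul_conj, Complex.ofReal_re, Complex.normSq_eq_norm_sq]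
  simp only [Complex.sub_re, Complex.zero_re, h2, Complex.mul_re, ← hi.2] at h1
  simp only [Complex.zero_re, Complex.zero_im] at h1 hi hj
  have : ‖W i j‖ ^ 2 ≤ t ^ 2 := by
    nlinarith [mul_le_mul (hd i) (hd j) hj.1 ht]
  exact abs_le_of_sq_le_sq' this ht |>.2

/-- The partial transpose of `∑ᵢⱼ Wᵢⱼ |ii⟩⟨jj|`. -/
def swapWeighted [DecidableEq ι] (W : Matrix ι ι ℂ) : Matrix (ι × ι) (ι × ι) ℂ :=
  Matrix.of fun p q => if q = p.swap then W p.1 p.2 else 0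

/-- The swap pairs coordinate `p` only with `p.swap`, so by AM–GM each cross term of the quadratic
form costs at most the average of `|x p|²` and `|x p.swap|²`. Summed over all `p`, these averages
give exactly `‖x‖²`. -/
theorem posSemidef_one_add_swapWeighted [DecidableEq ι] {W : Matrix ι ι ℂ} (hW : W.IsHermitian)
    {s : ℝ} (hs : ∀ i j, |s| * ‖W i j‖ ≤ 1) :
    (1 + (s : ℂ) • swapWeighted W).PosSemidef := by
  have hH : (1 + (s : ℂ) • swapWeighted W).IsHermitian := by
    refine Matrix.isHermitian_one.add ?_
    ext p q
    simp only [swapWeighted, Matrix.conjTranspose_apply, Matrix.smul_apply, Matrix.of_apply,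
      smul_eq_mul, star_mul', Complex.star_def, Complex.conj_ofReal]
    congr 1
    by_cases h : q = p.swap
    · subst h
      simp only [Prod.swap_swap, if_true, Prod.fst_swap, Prod.snd_swap]
      rw [← Complex.star_def, ← Matrix.conjTranspose_apply, hW.eq]
    · rw [if_neg h, if_neg, map_zero]
      rintro rfl
      exact h (Prod.swap_swap _).symm
  refine Matrix.PosSemidef.of_dotProduct_mulVec_nonneg hH fun x => ?_
  rw [Complex.le_def]
  refine ⟨?_, (hH.im_star_dotProduct_mulVec_self x).symm⟩
  have hmv : ∀ p, ((1 + (s : ℂ) • swapWeighted W) *ᵥ x) p = x p + s * W p.1 p.2 * x p.swap := by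
    intro p
    rw [Matrix.add_mulVec, Matrix.one_mulVec, Matrix.smul_mulVec, Pi.add_apply, Pi.smul_apply]
    simp [Matrix.mulVec, dotProduct, swapWeighted, mul_assoc]
  have hterm : ∀ p, ‖x p‖ ^ 2 - (‖x p‖ ^ 2 + ‖x p.swap‖ ^ 2) / 2 ≤
      (star (x p) * (x p + s * W p.1 p.2 * x p.swap)).re := by
    intro p
    have h1 : (star (x p) * x p).re = ‖x p‖ ^ 2 := by
      rw [mul_comm, Complex.star_def, Complex.mul_conj, Complex.ofReal_re,
        Complex.normSq_eq_norm_sq]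
    have h2 : -(‖x p‖ * ‖x p.swap‖) ≤ (star (x p) * (s * W p.1 p.2 * x p.swap)).re := by
      refine le_trans ?_ (neg_le_of_abs_le (Complex.abs_re_le_norm _))
      rw [neg_le_neg_iff, norm_mul, norm_mul, norm_mul, norm_star, Complex.norm_real,
        Real.norm_eq_abs]
      exact mul_le_mul_of_nonneg_left
        (mul_le_of_le_one_left (norm_nonneg _) (hs _ _)) (norm_nonneg _)
    rw [mul_add, Complex.add_re, h1]
    nlinarith [sq_nonneg (‖x p‖ - ‖x p.swap‖)]
  simp only [dotProduct, Complex.zero_re, Complex.re_sum, Pi.star_apply, hmv]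
  refine le_trans (le_of_eq ?_) (Finset.sum_le_sum fun p _ => hterm p)
  rw [Finset.sum_sub_distrib, ← Finset.sum_div, Finset.sum_add_distrib,
    show ∑ p : ι × ι, ‖x p.swap‖ ^ 2 = ∑ p, ‖x p‖ ^ 2 from
      Equiv.sum_comp (Equiv.prodComm ι ι) (fun p => ‖x p‖ ^ 2)]
  ring

/-! ### The trace norm of Hermitian matrices -/

variable [DecidableEq ι]

theorem traceNorm_eq_sum_abs_eigenvalues {X : Matrix ι ι ℂ} (hX : X.IsHermitian) :
    traceNorm X = ∑ i, |hX.eigenvalues i| := by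
  open scoped MatrixOrder in
  rw [traceNorm, CFC.abs_eq_cfc_norm X hX.isSelfAdjoint, hX.cfc_eq, Matrix.IsHermitian.cfc,
    Unitary.conjStarAlgAut_apply, Matrix.trace_mul_cycle, Unitary.coe_star_mul_self, one_mul,
    Matrix.trace_diagonal]
  simp

theorem traceNorm_of_posSemidef {X : Matrix ι ι ℂ} (hX : X.PosSemidef) :
    traceNorm X = X.trace.re := by
  open scoped MatrixOrder in
  rw [traceNorm, CFC.abs_of_nonneg X hX.nonneg]

/-- In an eigenbasis of `P - N` each eigenvalue is a difference of nonnegative diagonal entries of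
`P` and `N`. Together with the attaining decomposition into positive and negative parts, this lets
trace-norm bounds be handled by positivity alone. -/
theorem traceNorm_sub_le {P N : Matrix ι ι ℂ} (hP : P.PosSemidef) (hN : N.PosSemidef) :
    traceNorm (P - N) ≤ P.trace.re + N.trace.re := by
  have hX : (P - N).IsHermitian := hP.1.sub hN.1
  rw [traceNorm_eq_sum_abs_eigenvalues hX]
  set U : Matrix ι ι ℂ := (hX.eigenvectorUnitary : Matrix ι ι ℂ) with hU
  have hUU : U * star U = 1 := Unitary.coe_mul_star_self _
  have hP' := hP.conjTranspose_mul_mul_same U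
  have hN' := hN.conjTranspose_mul_mul_same U
  have hdiag : star U * (P - N) * U = Matrix.diagonal (RCLike.ofReal ∘ hX.eigenvalues) := by
    have h2 : star U * U = 1 := Unitary.coe_star_mul_self _
    conv_lhs => rw [hX.spectral_theorem, Unitary.conjStarAlgAut_apply]
    rw [← hU, ← mul_assoc, ← mul_assoc, h2, one_mul, mul_assoc, h2, mul_one]
  have htr : ∀ A : Matrix ι ι ℂ, (Uᴴ * A * U).trace = A.trace := by
    intro A
    rw [Matrix.trace_mul_cycle, ← star_eq_conjTranspose, hUU, one_mul]
  rw [← htr P, ← htr N, Matrix.trace, Matrix.trace, Complex.re_sum, Complex.re_sum,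
    ← Finset.sum_add_distrib]
  refine Finset.sum_le_sum fun i _ => ?_
  have hi : hX.eigenvalues i = ((Uᴴ * P * U) i i).re - ((Uᴴ * N * U) i i).re := by
    have := congrArg (fun A : Matrix ι ι ℂ => (A i i).re) hdiag
    simp only [Matrix.diagonal_apply_eq, Function.comp_apply] at this
    rw [star_eq_conjTranspose, Matrix.mul_sub, Matrix.sub_mul, Matrix.sub_apply,
      Complex.sub_re] at this
    rw [this]; rfl
  have h1 := (Complex.le_def.mp (hP'.diag_nonneg (i := i))).1
  have h2 := (Complex.le_def.mp (hN'.diag_nonneg (i := i))).1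
  simp only [Complex.zero_re] at h1 h2
  rw [hi, Matrix.diag_apply, Matrix.diag_apply, abs_le]
  constructor <;> linarith

theorem exists_posSemidef_sub_eq {X : Matrix ι ι ℂ} (hX : X.IsHermitian) :
    ∃ P N : Matrix ι ι ℂ, P.PosSemidef ∧ N.PosSemidef ∧ X = P - N ∧
      traceNorm X = P.trace.re + N.trace.re := by
  open scoped MatrixOrder in
  refine ⟨X⁺, X⁻, (CFC.posPart_nonneg X).posSemidef, (CFC.negPart_nonneg X).posSemidef,
    (CFC.posPart_sub_negPart X hX.isSelfAdjoint).symm, ?_⟩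
  rw [traceNorm, ← CFC.posPart_add_negPart X hX.isSelfAdjoint, Matrix.trace_add, Complex.add_re]

end Matrices

/-! ### Partial transposes, the maximally entangled state and maximally correlated operators. -/

section Bipartite

open Matrix
open scoped Kronecker

variable {n α β : Type*} [Fintype n] [DecidableEq n]
  [Fintype α] [DecidableEq α] [Fintype β] [DecidableEq β]

/-! ### Rank-one operators -/

theorem posSemidef_ketbra (x : EuclideanSpace ℂ n) : (ketbra x x).PosSemidef :=
  Matrix.posSemidef_vecMulVec_self_star x.ofLp

theorem trace_ketbra (x : EuclideanSpace ℂ n) : (ketbra x x).trace = ((‖x‖ ^ 2 : ℝ) : ℂ) := by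
  simp only [ketbra, Matrix.trace, Matrix.diag_apply, Matrix.of_apply, EuclideanSpace.norm_sq_eq,
    Complex.star_def, Complex.mul_conj, Complex.normSq_eq_norm_sq]
  push_cast
  rfl

theorem norm_tensorKet (x : EuclideanSpace ℂ α) (y : EuclideanSpace ℂ β) :
    ‖tensorKet x y‖ = ‖x‖ * ‖y‖ := by
  rw [← sq_eq_sq₀ (norm_nonneg _) (by positivity), mul_pow]
  simp only [EuclideanSpace.norm_sq_eq, tensorKet, Fintype.sum_prod_type, norm_mul, mul_pow,
    Finset.sum_mul_sum]

/-! ### The partial transpose -/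

theorem partialTranspose_apply (X : Matrix (α × β) (α × β) ℂ) (p q : α × β) :
    partialTranspose X p q = X (p.1, q.2) (q.1, p.2) := rfl

theorem partialTranspose_partialTranspose (X : Matrix (α × β) (α × β) ℂ) :
    partialTranspose (partialTranspose X) = X := rfl

theorem partialTranspose_add (X Y : Matrix (α × β) (α × β) ℂ) :
    partialTranspose (X + Y) = partialTranspose X + partialTranspose Y := rfl

theorem partialTranspose_sub (X Y : Matrix (α × β) (α × β) ℂ) :
    partialTranspose (X - Y) = partialTranspose X - partialTranspose Y := rfl

theorem partialTranspose_smul {R : Type*} [SMul R ℂ] (t : R) (X : Matrix (α × β) (α × β) ℂ) :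
    partialTranspose (t • X) = t • partialTranspose X := rfl

theorem partialTranspose_one : partialTranspose (1 : Matrix (α × β) (α × β) ℂ) = 1 := by
  ext p q
  simp only [partialTranspose_apply, Matrix.one_apply, Prod.ext_iff]
  congr 1
  exact propext ⟨fun h => ⟨h.1, h.2.symm⟩, fun h => ⟨h.1, h.2.symm⟩⟩

theorem trace_partialTranspose (X : Matrix (α × β) (α × β) ℂ) :
    (partialTranspose X).trace = X.trace := rfl

theorem trace_partialTranspose_mul_partialTranspose (X Y : Matrix (α × β) (α × β) ℂ) :
    (partialTranspose X * partialTranspose Y).trace = (X * Y).trace := by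
  simp only [Matrix.trace, Matrix.diag_apply, Matrix.mul_apply, partialTranspose_apply,
    Fintype.sum_prod_type]
  refine Finset.sum_congr rfl fun i _ => ?_
  rw [Finset.sum_comm]
  conv_rhs => rw [Finset.sum_comm]
  refine Finset.sum_congr rfl fun j _ => ?_
  rw [Finset.sum_comm]

theorem isHermitian_partialTranspose {X : Matrix (α × β) (α × β) ℂ} (hX : X.IsHermitian) :
    (partialTranspose X).IsHermitian := by
  ext p q
  exact congrFun (congrFun hX (p.1, q.2)) (q.1, p.2)

theorem posSemidef_partialTranspose_ketbra_tensorKet (x : EuclideanSpace ℂ α)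
    (y : EuclideanSpace ℂ β) :
    (partialTranspose (ketbra (tensorKet x y) (tensorKet x y))).PosSemidef := by
  have h := posSemidef_ketbra (tensorKet x (WithLp.toLp 2 (star y.ofLp)))
  convert! h using 1
  ext p q
  simp only [partialTranspose_apply, ketbra, tensorKet, Matrix.of_apply, star_mul', Pi.star_apply,
    star_star]
  ring

/-! ### Inclusions between the sets of operators -/

theorem convex_PPTplus : Convex ℝ (PPTplus : Set (Matrix (α × β) (α × β) ℂ)) := by
  rintro X ⟨hX1, hX2, hX3⟩ Y ⟨hY1, hY2, hY3⟩ s t hs ht hst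
  refine ⟨?_, (hX2.smul hs).add (hY2.smul ht), ?_⟩
  · rw [Matrix.trace_add, Matrix.trace_smul, Matrix.trace_smul, hX1, hY1, ← add_smul, hst, one_smul]
  · rw [partialTranspose_add, partialTranspose_smul, partialTranspose_smul]
    exact (hX3.smul hs).add (hY3.smul ht)

theorem SEP_subset_PPTplus : (SEP : Set (Matrix (α × β) (α × β) ℂ)) ⊆ PPTplus := by
  refine convexHull_min ?_ convex_PPTplus
  rintro _ ⟨x, y, hx, hy, rfl⟩
  refine ⟨?_, posSemidef_ketbra _, posSemidef_partialTranspose_ketbra_tensorKet x y⟩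
  rw [trace_ketbra, norm_tensorKet, hx, hy]
  norm_num

theorem PPTplus_subset_Rains : (PPTplus : Set (Matrix (α × β) (α × β) ℂ)) ⊆ Rains := by
  rintro X ⟨h1, h2, h3⟩
  refine ⟨h2, ?_⟩
  rw [traceNorm_of_posSemidef h3, trace_partialTranspose, h1, Complex.one_re]

theorem ketbra_tensorKet_mem_SEP {x : EuclideanSpace ℂ α} {y : EuclideanSpace ℂ β}
    (hx : ‖x‖ = 1) (hy : ‖y‖ = 1) : ketbra (tensorKet x y) (tensorKet x y) ∈ SEP :=
  subset_convexHull ℝ _ ⟨x, y, hx, hy, rfl⟩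

/-! ### The maximally entangled state -/

theorem maxEntKet_apply (m : ℕ) (p : Fin m × Fin m) :
    maxEntKet m p = if p.1 = p.2 then 1 / (Real.sqrt m : ℂ) else 0 := by
  simp only [maxEntKet, WithLp.ofLp_sum, Finset.sum_apply, WithLp.ofLp_smul, Pi.smul_apply,
    tensorKet, PiLp.single_apply, smul_eq_mul, mul_ite, mul_one, mul_zero]
  split_ifs with h
  · simp [h]
  · refine Finset.sum_eq_zero fun i _ => ?_
    split_ifs <;> simp_all

theorem maxEnt_apply (m : ℕ) (p q : Fin m × Fin m) :
    maxEnt m p q = if p.1 = p.2 ∧ q.1 = q.2 then 1 / (m : ℂ) else 0 := by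
  have h : (1 / (Real.sqrt m : ℂ)) * star (1 / (Real.sqrt m : ℂ)) = 1 / (m : ℂ) := by
    rw [Complex.star_def, map_div₀, map_one, Complex.conj_ofReal, div_mul_div_comm, one_mul,
      ← Complex.ofReal_mul, Real.mul_self_sqrt (Nat.cast_nonneg m), Complex.ofReal_natCast]
  simp only [maxEnt, ketbra, Matrix.of_apply, maxEntKet_apply]
  split_ifs <;> simp_all

theorem posSemidef_maxEnt (m : ℕ) : (maxEnt m).PosSemidef := posSemidef_ketbra _

theorem trace_maxEnt {m : ℕ} (hm : 1 ≤ m) : (maxEnt m).trace = 1 := by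
  have : (m : ℂ) ≠ 0 := by exact_mod_cast (by omega : m ≠ 0)
  simp [Matrix.trace, maxEnt_apply, Fintype.sum_prod_type, this]

theorem maxEnt_mul_self {m : ℕ} (hm : 1 ≤ m) : maxEnt m * maxEnt m = maxEnt m := by
  have : (m : ℂ) ≠ 0 := by exact_mod_cast (by omega : m ≠ 0)
  ext p q
  simp only [Matrix.mul_apply, maxEnt_apply, Fintype.sum_prod_type]
  by_cases hp : p.1 = p.2 <;> by_cases hq : q.1 = q.2 <;> simp [hp, hq, this]

/-- The flip operator on `ℂᵐ ⊗ ℂᵐ`. -/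
noncomputable def flip (m : ℕ) : Matrix (Fin m × Fin m) (Fin m × Fin m) ℂ :=
  swapWeighted (Matrix.of fun _ _ => 1)

theorem flip_apply (m : ℕ) (p q : Fin m × Fin m) :
    flip m p q = if q = p.swap then 1 else 0 := rfl

theorem partialTranspose_maxEnt (m : ℕ) :
    partialTranspose (maxEnt m) = (1 / (m : ℂ)) • flip m := by
  ext p q
  simp only [partialTranspose_apply, maxEnt_apply, Matrix.smul_apply, flip_apply, Prod.ext_iff,
    Prod.fst_swap, Prod.snd_swap, smul_eq_mul, mul_ite, mul_one, mul_zero]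
  congr 1
  exact propext ⟨fun h => ⟨h.2, h.1.symm⟩, fun h => ⟨h.2.symm, h.1⟩⟩

theorem posSemidef_one_add_flip (m : ℕ) : (1 + flip m).PosSemidef := by
  have h := posSemidef_one_add_swapWeighted (W := (Matrix.of fun _ _ : Fin m => (1 : ℂ)))
    (by ext; simp) (s := 1) (by simp)
  simpa [flip] using h

theorem posSemidef_one_sub_flip (m : ℕ) : (1 - flip m).PosSemidef := by
  have h := posSemidef_one_add_swapWeighted (W := (Matrix.of fun _ _ : Fin m => (1 : ℂ)))
    (by ext; simp) (s := -1) (by simp)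
  simpa [flip, sub_eq_add_neg] using h

/-- Moving the partial transpose onto both factors turns the overlap into `Tr ((P - N) F) / m`, with
`F` the flip and `P - N` the Jordan decomposition of the partial transpose of `Z`. Since `-1 ⪯ F ⪯
1`, this is at most `(Tr P + Tr N) / m`, and `Tr P + Tr N` is the trace norm. -/
theorem hs_maxEnt_le_of_mem_Rains {m : ℕ} {Z : Matrix (Fin m × Fin m) (Fin m × Fin m) ℂ}
    (hZ : Z ∈ Rains) : hs Z (maxEnt m) ≤ 1 / m := by
  obtain ⟨P, N, hP, hN, hPN, htr⟩ :=
    exists_posSemidef_sub_eq (isHermitian_partialTranspose hZ.1.1)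
  have h1 := trace_mul_nonneg_re hP (posSemidef_one_sub_flip m)
  have h2 := trace_mul_nonneg_re hN (posSemidef_one_add_flip m)
  rw [Matrix.mul_sub, Matrix.mul_one, Matrix.trace_sub, Complex.sub_re] at h1
  rw [Matrix.mul_add, Matrix.mul_one, Matrix.trace_add, Complex.add_re] at h2
  have h3 := hZ.2
  rw [htr] at h3
  rw [hs_eq_of_isHermitian hZ.1.1, ← trace_partialTranspose_mul_partialTranspose,
    partialTranspose_maxEnt, hPN, Matrix.mul_smul, Matrix.trace_smul, smul_eq_mul, one_div,
    ← Complex.ofReal_natCast, ← Complex.ofReal_inv, Complex.re_ofReal_mul, Matrix.sub_mul,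
    Matrix.trace_sub, Complex.sub_re, one_div]
  exact mul_le_of_le_one_right (by positivity) (by linarith)

/-! ### Operators in local orthonormal bases -/

/-- The unitary matrix whose columns are the vectors of an orthonormal basis. -/
noncomputable def basisMatrix (a : OrthonormalBasis n ℂ (EuclideanSpace ℂ n)) : Matrix n n ℂ :=
  Matrix.of fun x i => a i x

theorem conjTranspose_basisMatrix_mul_self (a : OrthonormalBasis n ℂ (EuclideanSpace ℂ n)) :
    (basisMatrix a)ᴴ * basisMatrix a = 1 := by
  ext i j
  have h := orthonormal_iff_ite.mp a.orthonormal i j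
  rw [Matrix.one_apply, ← h, PiLp.inner_apply, Matrix.mul_apply]
  refine Finset.sum_congr rfl fun x _ => ?_
  simp [basisMatrix, mul_comm]

theorem basisMatrix_mul_conjTranspose_self (a : OrthonormalBasis n ℂ (EuclideanSpace ℂ n)) :
    basisMatrix a * (basisMatrix a)ᴴ = 1 :=
  mul_eq_one_comm.mp (conjTranspose_basisMatrix_mul_self a)

/-- The isometry `|i⟩ ↦ |aᵢ bᵢ⟩`. -/
noncomputable def pairIsometry (a b : OrthonormalBasis n ℂ (EuclideanSpace ℂ n)) : Matrix (n × n) n ℂ :=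
  Matrix.of fun p i => a i p.1 * b i p.2

theorem conjTranspose_pairIsometry_mul_self
    (a b : OrthonormalBasis n ℂ (EuclideanSpace ℂ n)) :
    (pairIsometry a b)ᴴ * pairIsometry a b = 1 := by
  ext i j
  have ha := congrFun (congrFun (conjTranspose_basisMatrix_mul_self a) i) j
  have hb := congrFun (congrFun (conjTranspose_basisMatrix_mul_self b) i) j
  have : ((pairIsometry a b)ᴴ * pairIsometry a b) i j =
      ((basisMatrix a)ᴴ * basisMatrix a) i j * ((basisMatrix b)ᴴ * basisMatrix b) i j := by
    simp only [Matrix.mul_apply, Matrix.conjTranspose_apply, pairIsometry, basisMatrix,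
      Matrix.of_apply, Fintype.sum_prod_type, Finset.sum_mul_sum, star_mul']
    exact Finset.sum_congr rfl fun _ _ => Finset.sum_congr rfl fun _ _ => by ring
  rw [this, ha, hb, Matrix.one_apply]
  split_ifs <;> simp

theorem singleParty_eq (c : OrthonormalBasis n ℂ (EuclideanSpace ℂ n)) (r : Matrix n n ℂ) :
    singleParty c r = basisMatrix c * r * (basisMatrix c)ᴴ := by
  ext x y
  simp only [singleParty, Matrix.sum_apply, Matrix.smul_apply, ketbra, Matrix.of_apply,
    Matrix.mul_apply, basisMatrix, Matrix.conjTranspose_apply, smul_eq_mul, Finset.sum_mul]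
  rw [Finset.sum_comm]
  exact Finset.sum_congr rfl fun _ _ => Finset.sum_congr rfl fun _ _ => by ring

theorem maxCorr_apply (a b : OrthonormalBasis n ℂ (EuclideanSpace ℂ n)) (r : Matrix n n ℂ)
    (p q : n × n) : maxCorr a b r p q =
      ∑ i, ∑ j, r i j * (a i p.1 * b i p.2 * star (a j q.1 * b j q.2)) := by
  simp only [maxCorr, Matrix.sum_apply, Matrix.smul_apply, ketbra, Matrix.of_apply, tensorKet,
    smul_eq_mul]

theorem maxCorr_eq (a b : OrthonormalBasis n ℂ (EuclideanSpace ℂ n)) (r : Matrix n n ℂ) :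
    maxCorr a b r = pairIsometry a b * r * (pairIsometry a b)ᴴ := by
  ext p q
  rw [maxCorr_apply]
  simp only [Matrix.mul_apply, pairIsometry, Matrix.of_apply, Matrix.conjTranspose_apply,
    Finset.sum_mul]
  rw [Finset.sum_comm]
  exact Finset.sum_congr rfl fun _ _ => Finset.sum_congr rfl fun _ _ => by ring

theorem conjTranspose_mul_maxCorr_mul (a b : OrthonormalBasis n ℂ (EuclideanSpace ℂ n))
    (r : Matrix n n ℂ) : (pairIsometry a b)ᴴ * maxCorr a b r * pairIsometry a b = r := by
  rw [maxCorr_eq, ← Matrix.mul_assoc, ← Matrix.mul_assoc, conjTranspose_pairIsometry_mul_self,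
    Matrix.one_mul, Matrix.mul_assoc, conjTranspose_pairIsometry_mul_self, Matrix.mul_one]

theorem trace_maxCorr (a b : OrthonormalBasis n ℂ (EuclideanSpace ℂ n)) (r : Matrix n n ℂ) :
    (maxCorr a b r).trace = r.trace := by
  rw [maxCorr_eq, Matrix.trace_mul_cycle, conjTranspose_pairIsometry_mul_self, Matrix.one_mul]

theorem trace_maxCorr_mul_maxCorr (a b : OrthonormalBasis n ℂ (EuclideanSpace ℂ n))
    (r W : Matrix n n ℂ) : (maxCorr a b r * maxCorr a b W).trace = (r * W).trace := by
  conv_lhs => rw [maxCorr_eq a b W]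
  rw [← Matrix.mul_assoc, Matrix.trace_mul_comm, ← Matrix.mul_assoc, ← Matrix.mul_assoc,
    conjTranspose_mul_maxCorr_mul]

theorem IsState.of_maxCorr {a b : OrthonormalBasis n ℂ (EuclideanSpace ℂ n)} {r : Matrix n n ℂ}
    (h : IsState (maxCorr a b r)) : IsState r := by
  refine ⟨?_, by rw [← trace_maxCorr a b, h.2]⟩
  rw [← conjTranspose_mul_maxCorr_mul a b r]
  exact h.1.conjTranspose_mul_mul_same _

theorem posSemidef_maxCorr (a b : OrthonormalBasis n ℂ (EuclideanSpace ℂ n))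
    {W : Matrix n n ℂ} (hW : W.PosSemidef) : (maxCorr a b W).PosSemidef := by
  rw [maxCorr_eq]
  exact hW.mul_mul_conjTranspose_same _

theorem isEffect_maxCorr (a b : OrthonormalBasis n ℂ (EuclideanSpace ℂ n))
    {W : Matrix n n ℂ} (hW : IsEffect W) : IsEffect (maxCorr a b W) := by
  refine ⟨posSemidef_maxCorr a b hW.1, ?_⟩
  set V := pairIsometry a b with hV
  have hVV : Vᴴ * V = 1 := conjTranspose_pairIsometry_mul_self a b
  have hVVV : V * Vᴴ * (V * Vᴴ) = V * Vᴴ := by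
    rw [Matrix.mul_assoc, ← Matrix.mul_assoc Vᴴ, hVV, Matrix.one_mul]
  have h1 : (1 - V * Vᴴ).PosSemidef := by
    have := Matrix.posSemidef_conjTranspose_mul_self (1 - V * Vᴴ)
    rwa [Matrix.conjTranspose_sub, Matrix.conjTranspose_mul, Matrix.conjTranspose_conjTranspose,
      Matrix.conjTranspose_one, Matrix.sub_mul, Matrix.mul_sub, Matrix.mul_one, Matrix.one_mul,
      Matrix.mul_sub, Matrix.mul_one, hVVV, sub_self, sub_zero] at this
  have h2 := hW.2.mul_mul_conjTranspose_same V
  -- The first summand is the projector onto the complement of the range of `V`; the second is the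
  -- compressed effect inequality on that range.
  have : 1 - maxCorr a b W = (1 - V * Vᴴ) + V * (1 - W) * Vᴴ := by
    rw [maxCorr_eq, ← hV, Matrix.mul_sub, Matrix.mul_one, Matrix.sub_mul]
    abel
  rw [this]
  exact h1.add h2

/-- Partial transposition exchanges the `b`-vectors of ket and bra and conjugates them, so local
bases enter only through the unitary `U_a ⊗ conj U_b`. What remains is the swap weighted by `W`,
independent of the bases. -/
theorem partialTranspose_maxCorr (a b : OrthonormalBasis n ℂ (EuclideanSpace ℂ n))
    (W : Matrix n n ℂ) :
    partialTranspose (maxCorr a b W) = (basisMatrix a ⊗ₖ (basisMatrix b).map star) *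
      swapWeighted W * (basisMatrix a ⊗ₖ (basisMatrix b).map star)ᴴ := by
  ext p q
  rw [partialTranspose_apply, maxCorr_apply]
  simp only [Matrix.mul_apply, Matrix.conjTranspose_apply, swapWeighted, Matrix.of_apply, mul_ite,
    mul_zero]
  simp only [← Prod.swap_eq_iff_eq_swap, Finset.sum_ite_eq, Finset.mem_univ, if_true]
  rw [Fintype.sum_prod_type, Finset.sum_comm]
  refine Finset.sum_congr rfl fun _ _ => Finset.sum_congr rfl fun _ _ => ?_
  simp only [basisMatrix, Matrix.kroneckerMap_apply, Matrix.map_apply, Matrix.of_apply,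
    Prod.fst_swap, Prod.snd_swap, star_mul', star_star]
  ring

theorem posSemidef_one_add_smul_partialTranspose_maxCorr
    (a b : OrthonormalBasis n ℂ (EuclideanSpace ℂ n)) {W : Matrix n n ℂ} (hW : W.IsHermitian)
    {s : ℝ} (hs : ∀ i j, |s| * ‖W i j‖ ≤ 1) :
    (1 + (s : ℂ) • partialTranspose (maxCorr a b W)).PosSemidef := by
  set U := basisMatrix a ⊗ₖ (basisMatrix b).map star with hU
  have hb : (basisMatrix b).map star * ((basisMatrix b).map star)ᴴ = 1 := by
    have h := congrArg Matrix.transpose (basisMatrix_mul_conjTranspose_self b)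
    rw [Matrix.transpose_mul, Matrix.transpose_one] at h
    convert! h using 2
    ext
    simp
  have hUU : U * Uᴴ = 1 := by
    rw [hU, Matrix.conjTranspose_kronecker, ← Matrix.mul_kronecker_mul,
      basisMatrix_mul_conjTranspose_self, hb, Matrix.one_kronecker_one]
  have h := (posSemidef_one_add_swapWeighted hW hs).mul_mul_conjTranspose_same U
  rwa [Matrix.mul_add, Matrix.mul_one, Matrix.add_mul, hUU, Matrix.mul_smul, Matrix.smul_mul,
    hU, ← partialTranspose_maxCorr] at h

end Bipartite

/-! ### Adjoint action of channels, measure-and-prepare channels and PPT operations. -/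

section Operations

open Matrix
open scoped Kronecker

variable {ι κ : Type*} [Fintype ι] [Fintype κ]

theorem IsCPTP.posSemidef {Λ : OpMap ι κ} (hΛ : IsCPTP Λ) {X : Matrix ι ι ℂ}
    (hX : X.PosSemidef) : (Λ X).PosSemidef :=
  (hΛ.1 1 _ (hX.submatrix Prod.fst)).submatrix fun u => (u, 0)

/-- The image of the observable `E` under the adjoint of `X ↦ Λ (V X V†)`. -/
noncomputable def pullback {d : ℕ} (Λ : OpMap ι κ) (V : Matrix ι (Fin d) ℂ) (E : Matrix κ κ ℂ) :
    Matrix (Fin d) (Fin d) ℂ :=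
  Matrix.of fun j i => (Λ (V * Matrix.single i j (1 : ℂ) * Vᴴ) * E).trace

section Pullback

variable {d : ℕ} (Λ : OpMap ι κ) (V : Matrix ι (Fin d) ℂ)

theorem trace_mul_pullback (E : Matrix κ κ ℂ) (X : Matrix (Fin d) (Fin d) ℂ) :
    (X * pullback Λ V E).trace = (Λ (V * X * Vᴴ) * E).trace := by
  have hl : (X * pullback Λ V E).trace = ∑ i, ∑ j, X i j * pullback Λ V E j i := by
    simp only [Matrix.trace, Matrix.diag_apply, Matrix.mul_apply]
  rw [hl]
  conv_rhs => rw [Matrix.matrix_eq_sum_single X]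
  simp only [Matrix.mul_sum, Matrix.sum_mul, map_sum, Matrix.trace_sum]
  refine Finset.sum_congr rfl fun i _ => Finset.sum_congr rfl fun j _ => ?_
  rw [show Matrix.single i j (X i j) = X i j • Matrix.single i j (1 : ℂ) by
    rw [Matrix.smul_single, smul_eq_mul, mul_one], Matrix.mul_smul, Matrix.smul_mul, map_smul,
    Matrix.smul_mul, Matrix.trace_smul, smul_eq_mul]
  rfl

theorem pullback_sub (E F : Matrix κ κ ℂ) :
    pullback Λ V (E - F) = pullback Λ V E - pullback Λ V F := by
  ext i j
  simp [pullback, Matrix.mul_sub]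

variable {Λ V}

/-- Applying `Λ ⊗ id` to the unnormalised vector with coefficients `V` yields the Choi matrix of `X
↦ Λ (V X V†)`. The pullback is a contraction of this matrix with `E`, up to transposes, which is
where complete positivity enters. -/
theorem posSemidef_pullback (hΛ : IsCPTP Λ) {E : Matrix κ κ ℂ} (hE : E.PosSemidef) :
    (pullback Λ V E).PosSemidef := by
  have h := hΛ.1 d _ (Matrix.posSemidef_vecMulVec_self_star fun p : ι × Fin d => V p.1 p.2)
  have h2 := (posSemidef_contract hE.transpose h).transpose
  convert! h2 using 1
  ext j i
  simp only [pullback, Matrix.of_apply, Matrix.transpose_apply, ampliation, Matrix.trace,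
    Matrix.diag_apply, Matrix.mul_apply]
  refine Finset.sum_congr rfl fun u _ => Finset.sum_congr rfl fun v _ => ?_
  rw [mul_comm]
  refine congrArg (E v u * ·) (congrFun (congrFun (congrArg Λ ?_) u) v)
  ext x y
  simp [Matrix.mul_apply, Matrix.vecMulVec_apply, Matrix.single_apply, Matrix.conjTranspose_apply,
    ite_and]

theorem pullback_one [DecidableEq κ] (hΛ : IsCPTP Λ) (hV : Vᴴ * V = 1) : pullback Λ V 1 = 1 := by
  ext j i
  rw [pullback, Matrix.of_apply, Matrix.mul_one, hΛ.2, Matrix.trace_mul_cycle, hV, Matrix.one_mul,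
    Matrix.one_apply]
  by_cases h : j = i
  · subst h
    simp
  · simp [h, Matrix.trace_single_eq_of_ne _ _ _ (Ne.symm h)]

theorem isEffect_pullback [DecidableEq κ] (hΛ : IsCPTP Λ) (hV : Vᴴ * V = 1) {E : Matrix κ κ ℂ}
    (hE : IsEffect E) : IsEffect (pullback Λ V E) := by
  refine ⟨posSemidef_pullback hΛ hE.1, ?_⟩
  rw [← pullback_one hΛ hV, ← pullback_sub]
  exact posSemidef_pullback hΛ hE.2

end Pullback

/-! ### Measure-and-prepare channels -/

/-- The map that measures the effect `M` and prepares `σ` on success and `τ` on failure. -/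
noncomputable def measurePrepare [DecidableEq ι] (M : Matrix ι ι ℂ) (σ τ : Matrix κ κ ℂ) :
    OpMap ι κ where
  toFun X := (X * M).trace • σ + (X * (1 - M)).trace • τ
  map_add' X Y := by
    simp only [Matrix.add_mul, Matrix.trace_add, add_smul]
    abel
  map_smul' t X := by
    simp only [Matrix.smul_mul, Matrix.trace_smul, smul_assoc, smul_add, RingHom.id_apply]

theorem measurePrepare_apply [DecidableEq ι] (M : Matrix ι ι ℂ) (σ τ : Matrix κ κ ℂ)
    (X : Matrix ι ι ℂ) :
    measurePrepare M σ τ X = (X * M).trace • σ + (X * (1 - M)).trace • τ := rfl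

theorem isCPTP_measurePrepare [DecidableEq ι] {M : Matrix ι ι ℂ} {σ τ : Matrix κ κ ℂ}
    (hM : IsEffect M) (hσ : IsState σ) (hτ : IsState τ) : IsCPTP (measurePrepare M σ τ) := by
  constructor
  · intro k X hX
    -- Each branch of the ampliated map is the prepared state tensored with a contraction of `X`
    -- against the transposed effect.
    have key : ∀ {A : Matrix ι ι ℂ} {ξ : Matrix κ κ ℂ}, A.PosSemidef → ξ.PosSemidef →
        (ξ ⊗ₖ (Matrix.of fun p q : Fin k => ∑ x, ∑ y, Aᵀ x y * X (x, p) (y, q))).PosSemidef :=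
      fun hA hξ => hξ.kronecker (posSemidef_contract hA.transpose hX)
    convert! (key hM.1 hσ.1).add (key hM.2 hτ.1) using 1
    ext p q
    simp only [ampliation, measurePrepare_apply, Matrix.add_apply, Matrix.smul_apply,
      Matrix.of_apply, Matrix.kroneckerMap_apply, smul_eq_mul, Matrix.trace, Matrix.diag_apply,
      Matrix.mul_apply, Matrix.transpose_apply]
    congr 1 <;>
    · rw [mul_comm]
      congr 1
      exact Finset.sum_congr rfl fun _ _ => Finset.sum_congr rfl fun _ _ => mul_comm _ _
  · intro X
    rw [measurePrepare_apply, Matrix.trace_add, Matrix.trace_smul, Matrix.trace_smul, hσ.2, hτ.2,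
      smul_eq_mul, smul_eq_mul, mul_one, mul_one, ← Matrix.trace_add, ← Matrix.mul_add,
      add_sub_cancel, Matrix.mul_one]

/-! ### PPT operations -/

variable {α β α' β' : Type*} [Fintype α] [DecidableEq α] [Fintype β] [DecidableEq β]
  [Fintype α'] [DecidableEq α'] [Fintype β'] [DecidableEq β']

/-- Conjugating `Λ` by partial transposes gives the map whose Choi matrix is the partially
transposed one. Positivity of that Choi matrix makes the conjugated map positive. -/
theorem posSemidef_partialTranspose_map_partialTranspose {Λ : OpMap (α × β) (α' × β')}
    (hΛ : (partialTranspose (choi Λ)).PosSemidef) {Y : Matrix (α × β) (α × β) ℂ}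
    (hY : Y.PosSemidef) : (partialTranspose (Λ (partialTranspose Y))).PosSemidef := by
  have h := posSemidef_contract hY
    (hΛ.submatrix fun p : (α × β) × (α' × β') => ((p.1.1, p.2.1), (p.1.2, p.2.2)))
  convert! h using 1
  ext u v
  have hlin : ∀ (Z : Matrix (α × β) (α × β) ℂ) (u v : α' × β'),
      Λ Z u v = ∑ x, ∑ y, Z x y * Λ (Matrix.single x y 1) u v := by
    intro Z u v
    conv_lhs => rw [Matrix.matrix_eq_sum_single Z]
    simp only [map_sum, Matrix.sum_apply]
    refine Finset.sum_congr rfl fun x _ => Finset.sum_congr rfl fun y _ => ?_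
    rw [show Matrix.single x y (Z x y) = Z x y • Matrix.single x y (1 : ℂ) by
      rw [Matrix.smul_single, smul_eq_mul, mul_one], map_smul, Matrix.smul_apply, smul_eq_mul]
  rw [partialTranspose_apply, hlin]
  simp only [Matrix.of_apply, Matrix.submatrix_apply, partialTranspose_apply, choi,
    Fintype.sum_prod_type]
  refine Finset.sum_congr rfl fun i _ => ?_
  rw [Finset.sum_comm]
  conv_rhs => rw [Finset.sum_comm]
  refine Finset.sum_congr rfl fun j _ => ?_
  rw [Finset.sum_comm]

theorem channels_PPT_subset_PPTplusPreserving :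
    (OpClass.PPT.channels : Set (OpMap (α × β) (α' × β'))) ⊆
      OpClass.PPTplusPreserving.channels := by
  rintro Λ ⟨h1, h2⟩
  refine ⟨h1, fun X hX => ⟨by rw [h1.2, hX.1], h1.posSemidef hX.2.1, ?_⟩⟩
  exact posSemidef_partialTranspose_map_partialTranspose h2 hX.2.2

theorem channels_PPT_subset_RainsPreserving :
    (OpClass.PPT.channels : Set (OpMap (α × β) (α' × β'))) ⊆
      OpClass.RainsPreserving.channels := by
  rintro Λ ⟨h1, h2⟩
  refine ⟨h1, fun X hX => ⟨h1.posSemidef hX.1, ?_⟩⟩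
  obtain ⟨P, N, hP, hN, hPN, htr⟩ :=
    exists_posSemidef_sub_eq (isHermitian_partialTranspose hX.1.1)
  have hX' : X = partialTranspose P - partialTranspose N := by
    rw [← partialTranspose_sub, ← hPN, partialTranspose_partialTranspose]
  rw [hX', map_sub, partialTranspose_sub]
  refine (traceNorm_sub_le (posSemidef_partialTranspose_map_partialTranspose h2 hP)
    (posSemidef_partialTranspose_map_partialTranspose h2 hN)).trans ?_
  rw [trace_partialTranspose, trace_partialTranspose, h1.2, h1.2, trace_partialTranspose,
    trace_partialTranspose, ← htr]
  exact hX.2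

theorem OpClass.isCPTP_of_mem_channels {O : OpClass} {Λ : OpMap (α × β) (α' × β')}
    (hΛ : Λ ∈ O.channels) : IsCPTP Λ := by
  cases O <;> exact hΛ.1

/-- Along `SEP ⊆ PPTplus ⊆ Rains`, every class preserves at least one of the three sets, so the
weakest common conclusion holds for all. This is the only property of the classes, besides being
channels, used in the converse. -/
theorem OpClass.map_mem_Rains {O : OpClass} {Λ : OpMap (α × β) (α' × β')}
    (hΛ : Λ ∈ O.channels) {X : Matrix (α × β) (α × β) ℂ} (hX : X ∈ SEP) : Λ X ∈ Rains := by
  have h1 := SEP_subset_PPTplus hX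
  cases O with
  | PPT => exact (channels_PPT_subset_RainsPreserving hΛ).2 _ (PPTplus_subset_Rains h1)
  | RainsPreserving => exact hΛ.2 _ (PPTplus_subset_Rains h1)
  | PPTplusPreserving => exact PPTplus_subset_Rains (hΛ.2 _ h1)
  | SEPP => exact PPTplus_subset_Rains (SEP_subset_PPTplus (hΛ.2 _ hX))

/-- Up to regrouping tensor factors, the Choi matrix is `Mᵀ ⊗ σ + (1 - M)ᵀ ⊗ τ`, and partial
transposition acts on each factor separately. -/
theorem posSemidef_partialTranspose_choi_measurePrepare {M : Matrix (α × β) (α × β) ℂ}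
    {σ τ : Matrix (α' × β') (α' × β') ℂ}
    (h : ((partialTranspose M)ᵀ ⊗ₖ partialTranspose σ +
      (1 - partialTranspose M)ᵀ ⊗ₖ partialTranspose τ).PosSemidef) :
    (partialTranspose (choi (measurePrepare M σ τ))).PosSemidef := by
  have h2 := h.submatrix
    fun p : (α × α') × (β × β') => ((p.1.1, p.2.1), (p.1.2, p.2.2))
  convert! h2 using 1
  rw [← partialTranspose_one, ← partialTranspose_sub]
  ext p q
  simp [partialTranspose_apply, choi, measurePrepare_apply, Matrix.trace_single_mul]

end Operations

/-! ### Separable mixtures of the maximally entangled state with off-diagonal noise. -/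

section Separability

open Matrix
open scoped Kronecker

/-- The normalised projector onto `span {|ij⟩ | i ≠ j}`. -/
noncomputable def offDiagState (m : ℕ) : Matrix (Fin m × Fin m) (Fin m × Fin m) ℂ :=
  Matrix.diagonal fun p => if p.1 ≠ p.2 then ((m : ℂ) * (m - 1))⁻¹ else 0

theorem tensorKet_single {m : ℕ} (p : Fin m × Fin m) :
    tensorKet (EuclideanSpace.single p.1 (1 : ℂ)) (EuclideanSpace.single p.2 (1 : ℂ)) =
      EuclideanSpace.single p 1 := by
  ext q
  simp only [tensorKet, PiLp.single_apply, Prod.ext_iff]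
  split_ifs <;> simp_all

theorem sum_offDiag_weight {m : ℕ} (hm : 2 ≤ m) :
    ∑ p : Fin m × Fin m, (if p.1 ≠ p.2 then ((m : ℝ) * (m - 1))⁻¹ else 0) = 1 := by
  have h0 : (m : ℝ) ≠ 0 := by positivity
  have h1 : (m : ℝ) - 1 ≠ 0 := by
    have : (2 : ℝ) ≤ m := by exact_mod_cast hm
    linarith
  have h : ∀ i : Fin m, ∑ j : Fin m, (if i ≠ j then ((m : ℝ) * (m - 1))⁻¹ else 0) = (m : ℝ)⁻¹ := by
    intro i
    rw [← Finset.sum_filter, Finset.sum_const, Finset.filter_ne, Finset.card_erase_of_mem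
      (Finset.mem_univ _), Finset.card_univ, Fintype.card_fin, nsmul_eq_mul,
      Nat.cast_sub (by omega)]
    field_simp
    simp
  simp only [Fintype.sum_prod_type, h]
  simp [h0]

theorem offDiagState_eq_sum (m : ℕ) :
    offDiagState m = ∑ p : Fin m × Fin m, (if p.1 ≠ p.2 then ((m : ℝ) * (m - 1))⁻¹ else 0) •
      ketbra (tensorKet (EuclideanSpace.single p.1 (1 : ℂ)) (EuclideanSpace.single p.2 (1 : ℂ)))
        (tensorKet (EuclideanSpace.single p.1 (1 : ℂ)) (EuclideanSpace.single p.2 (1 : ℂ))) := by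
  ext p q
  rw [Matrix.sum_apply, Finset.sum_eq_single p]
  · simp only [tensorKet_single, ketbra, Matrix.smul_apply, Matrix.of_apply, PiLp.single_apply,
      offDiagState, Matrix.diagonal_apply, if_true, Complex.real_smul]
    by_cases hpq : p = q
    · subst hpq
      split_ifs <;> simp
    · simp [hpq, Ne.symm hpq]
  · intro x _ hx
    simp [tensorKet_single, ketbra, Ne.symm hx]
  · simp

theorem offDiagState_mem_SEP {m : ℕ} (hm : 2 ≤ m) : offDiagState m ∈ SEP := by
  rw [offDiagState_eq_sum]
  refine (convex_convexHull ℝ _).sum_mem (fun p _ => ?_) (sum_offDiag_weight hm)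
    fun p _ => ketbra_tensorKet_mem_SEP (by simp) (by simp)
  have : (2 : ℝ) ≤ m := by exact_mod_cast hm
  split_ifs
  · exact inv_nonneg.mpr (mul_nonneg (by linarith) (by linarith))
  · exact le_rfl

theorem trace_offDiagState_mul_maxEnt (m : ℕ) : (offDiagState m * maxEnt m).trace = 0 := by
  simp only [offDiagState, Matrix.trace, Matrix.diag_apply, Matrix.diagonal_mul, maxEnt_apply]
  refine Finset.sum_eq_zero fun p _ => ?_
  split_ifs <;> simp_all

/-- The character `f ↦ χ(fᵢ - fⱼ - fₖ + fₗ)` of `(ℤ/3)ᵐ`. -/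
noncomputable def phaseChar {m : ℕ} (p q : Fin m × Fin m) : AddChar (Fin m → ZMod 3) ℂ where
  toFun f := ZMod.stdAddChar (f p.1 - f p.2 - f q.1 + f q.2)
  map_zero_eq_one' := by simp
  map_add_eq_mul' f g := by
    rw [← AddChar.map_add_eq_mul]
    congr 1
    simp only [Pi.add_apply]
    ring

/-- Orthogonality of characters: the sum vanishes unless the exponent is identically zero. The
modulus three matters because for `q = p.swap` the exponent is `2 (fᵢ - fⱼ)`, which would vanish
modulo two. -/
theorem sum_phaseChar {m : ℕ} (p q : Fin m × Fin m) :
    ∑ f, phaseChar p q f =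
      if (p.1 = p.2 ∧ q.1 = q.2) ∨ p = q then (3 : ℂ) ^ m else 0 := by
  split_ifs with h
  · have : ∀ f, phaseChar p q f = 1 := by
      intro f
      show ZMod.stdAddChar (f p.1 - f p.2 - f q.1 + f q.2) = 1
      rcases h with ⟨h1, h2⟩ | rfl
      · simp [h1, h2]
      · simp
    simp [this]
  · rw [AddChar.sum_eq_zero_of_ne_one]
    intro h1
    have key : ∀ f : Fin m → ZMod 3, f p.1 - f p.2 - f q.1 + f q.2 = 0 := by
      intro f
      refine ZMod.injective_stdAddChar ?_
      rw [AddChar.map_zero_eq_one]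
      exact DFunLike.congr_fun h1 f
    obtain ⟨i, j⟩ := p
    obtain ⟨k, l⟩ := q
    simp only [Prod.mk.injEq] at h key
    -- Evaluating the exponent at unit vectors isolates one coefficient: use `k` when `i = j`, `j`
    -- when `i = k ≠ j`, and `i` otherwise, where the coefficient is 1 or, if `l = i`, 2.
    have hi := key (Pi.single i 1)
    have hj := key (Pi.single j 1)
    have hk := key (Pi.single k 1)
    have e0 : (1 : ZMod 3) ≠ 0 := by decide
    have e1 : (1 : ZMod 3) + 1 ≠ 0 := by decide
    have e2 : (-1 : ZMod 3) ≠ 0 := by decide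
    simp only [Pi.single_apply] at hi hj hk
    by_cases hij : i = j
    · subst hij
      have hkl : k ≠ l := fun e => h (Or.inl ⟨rfl, e⟩)
      simp [hkl.symm] at hk
    · by_cases hik : i = k
      · subst hik
        have hjl : j ≠ l := fun e => h (Or.inr ⟨rfl, e⟩)
        simp [hij, hjl.symm] at hj
      · by_cases hil : l = i
        · simp [Ne.symm hij, Ne.symm hik, hil, e1] at hi
        · simp [Ne.symm hij, Ne.symm hik, hil] at hi

/-- The vector `∑ₖ χ(fₖ) |k⟩ / √m`. -/
noncomputable def phaseKet {m : ℕ} (f : Fin m → ZMod 3) : EuclideanSpace ℂ (Fin m) :=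
  WithLp.toLp 2 fun k => (Real.sqrt m : ℂ)⁻¹ * ZMod.stdAddChar (f k)

theorem norm_phaseKet {m : ℕ} (hm : 1 ≤ m) (f : Fin m → ZMod 3) : ‖phaseKet f‖ = 1 := by
  have h0 : (m : ℝ) ≠ 0 := by positivity
  rw [← sq_eq_sq₀ (norm_nonneg _) zero_le_one, EuclideanSpace.norm_sq_eq]
  simp [phaseKet, AddChar.norm_apply, h0]

theorem ketbra_tensorKet_phaseKet {m : ℕ} (f : Fin m → ZMod 3) (p q : Fin m × Fin m) :
    ketbra (tensorKet (phaseKet f) (phaseKet (-f))) (tensorKet (phaseKet f) (phaseKet (-f))) p q =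
      ((m : ℂ) ^ 2)⁻¹ * phaseChar p q f := by
  have hs : (Real.sqrt m : ℂ) * (Real.sqrt m : ℂ) = m := by
    rw [← Complex.ofReal_mul, Real.mul_self_sqrt (Nat.cast_nonneg m), Complex.ofReal_natCast]
  have hc : ∀ x : ZMod 3, star (ZMod.stdAddChar x : ℂ) = ZMod.stdAddChar (-x) := by
    intro x
    rw [AddChar.map_neg_eq_conj]
    rfl
  have hr : phaseChar p q f = ZMod.stdAddChar (f p.1) * ZMod.stdAddChar (-f p.2) *
      (ZMod.stdAddChar (-f q.1) * ZMod.stdAddChar (f q.2)) := by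
    rw [← AddChar.map_add_eq_mul, ← AddChar.map_add_eq_mul, ← AddChar.map_add_eq_mul]
    show ZMod.stdAddChar _ = _
    congr 1
    ring
  simp only [ketbra, tensorKet, phaseKet, Matrix.of_apply, star_mul', hc, Pi.neg_apply, neg_neg, hr,
    star_inv₀, Complex.star_def, Complex.conj_ofReal]
  rw [← hs]
  ring

/-- Averaging the product vectors `phaseKet f ⊗ phaseKet (-f)` over all phases leaves `1/m²` exactly
at the entries that are diagonal or couple some `|ii⟩` with some `|kk⟩`. These are the entries of
the given mixture. -/
theorem boundary_mem_SEP {m : ℕ} (hm : 2 ≤ m) :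
    ((m : ℝ)⁻¹) • maxEnt m + (1 - (m : ℝ)⁻¹) • offDiagState m ∈ SEP := by
  have hw : ∀ f ∈ (Finset.univ : Finset (Fin m → ZMod 3)), (0 : ℝ) ≤ ((3 : ℝ) ^ m)⁻¹ :=
    fun _ _ => by positivity
  have h := (convex_convexHull ℝ _ : Convex ℝ (SEP (α := Fin m) (β := Fin m))).sum_mem hw
    (by simp) (z := fun f =>
      ketbra (tensorKet (phaseKet f) (phaseKet (-f))) (tensorKet (phaseKet f) (phaseKet (-f))))
    fun f _ => ketbra_tensorKet_mem_SEP (norm_phaseKet (by omega) _) (norm_phaseKet (by omega) _)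
  convert! h using 1
  ext p q
  have h0 : (m : ℂ) ≠ 0 := by exact_mod_cast (by omega : m ≠ 0)
  have h1 : (m : ℂ) - 1 ≠ 0 := by
    rw [sub_ne_zero]
    exact_mod_cast (by omega : m ≠ 1)
  simp only [Matrix.sum_apply, Matrix.smul_apply, ketbra_tensorKet_phaseKet,
    ← Finset.mul_sum, sum_phaseChar, Matrix.add_apply, maxEnt_apply, offDiagState,
    Matrix.diagonal_apply, Complex.real_smul]
  push_cast
  by_cases hpq : p = q
  · subst hpq
    by_cases hp : p.1 = p.2
    · simp [hp]
      field_simp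
    · simp [hp]
      field_simp
  · simp only [hpq, or_false, if_false, mul_zero, add_zero]
    split_ifs
    · field_simp
    · simp

theorem mixture_mem_SEP {m : ℕ} (hm : 2 ≤ m) {t : ℝ} (h0 : 0 ≤ t) (h1 : t ≤ 1 / m) :
    t • maxEnt m + (1 - t) • offDiagState m ∈ SEP := by
  have hm0 : (0 : ℝ) < m := by positivity
  have hm1 : (m : ℝ) * (m : ℝ)⁻¹ = 1 := mul_inv_cancel₀ hm0.ne'
  have htm : m * t ≤ 1 := by
    rw [le_div_iff₀ hm0] at h1
    linarith
  -- Weight `m t` on the extreme mixture reproduces the coefficient `t` of `maxEnt m`.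
  have h := (convex_convexHull ℝ _ : Convex ℝ (SEP (α := Fin m) (β := Fin m)))
    (boundary_mem_SEP hm) (offDiagState_mem_SEP hm) (mul_nonneg hm0.le h0)
    (sub_nonneg.mpr htm) (by ring)
  convert! h using 1
  rw [smul_add, smul_smul, smul_smul, add_assoc, ← add_smul]
  congr 2
  · linear_combination -t * hm1
  · linear_combination t * hm1

theorem isState_of_mem_SEP {α β : Type*} [Fintype α] [DecidableEq α] [Fintype β] [DecidableEq β]
    {X : Matrix (α × β) (α × β) ℂ} (hX : X ∈ SEP) : IsState X :=
  ⟨(SEP_subset_PPTplus hX).2.1, (SEP_subset_PPTplus hX).1⟩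

end Separability

/-! ### The channels attaining the fidelity. -/

section Achievability

open Matrix
open scoped Kronecker

variable {α β : Type*} [Fintype α] [DecidableEq α] [Fintype β] [DecidableEq β]

theorem isState_maxEnt {m : ℕ} (hm : 1 ≤ m) : IsState (maxEnt m) :=
  ⟨posSemidef_maxEnt m, trace_maxEnt hm⟩

theorem isEffect_maxEnt {m : ℕ} (hm : 1 ≤ m) : IsEffect (maxEnt m) := by
  refine ⟨posSemidef_maxEnt m, ?_⟩
  have := Matrix.posSemidef_conjTranspose_mul_self (1 - maxEnt m)
  rwa [Matrix.conjTranspose_sub, Matrix.conjTranspose_one, (posSemidef_maxEnt m).1.eq,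
    Matrix.sub_mul, Matrix.one_mul, Matrix.mul_sub, Matrix.mul_one, maxEnt_mul_self hm, sub_self,
    sub_zero] at this

/-- The normalised projector onto the complement of the maximally entangled vector. -/
noncomputable def complState (m : ℕ) : Matrix (Fin m × Fin m) (Fin m × Fin m) ℂ :=
  ((m : ℝ) ^ 2 - 1)⁻¹ • (1 - maxEnt m)

theorem isState_complState {m : ℕ} (hm : 2 ≤ m) : IsState (complState m) := by
  have h : (0 : ℝ) < (m : ℝ) ^ 2 - 1 := by
    have : (2 : ℝ) ≤ m := by exact_mod_cast hm
    nlinarith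
  refine ⟨(isEffect_maxEnt (by omega)).2.smul (inv_nonneg.mpr h.le), ?_⟩
  rw [complState, Matrix.trace_smul, Matrix.trace_sub, trace_maxEnt (by omega), Matrix.trace_one,
    Complex.real_smul]
  have h' : (m : ℂ) ^ 2 - 1 ≠ 0 := by exact_mod_cast h.ne'
  simp only [Fintype.card_prod, Fintype.card_fin]
  push_cast
  rw [← sq, inv_mul_cancel₀ h']

theorem trace_complState_mul_maxEnt {m : ℕ} (hm : 1 ≤ m) :
    (complState m * maxEnt m).trace = 0 := by
  rw [complState, Matrix.smul_mul, Matrix.sub_mul, Matrix.one_mul, maxEnt_mul_self hm, sub_self,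
    smul_zero, Matrix.trace_zero]

theorem measurePrepare_complState_mem_PPT {m : ℕ} (hm : 2 ≤ m)
    {M : Matrix (α × β) (α × β) ℂ} (hM : IsEffect M)
    (hadd : (1 + ((m : ℝ) : ℂ) • partialTranspose M).PosSemidef)
    (hsub : (1 + ((-m : ℝ) : ℂ) • partialTranspose M).PosSemidef) :
    measurePrepare M (maxEnt m) (complState m) ∈ OpClass.PPT.channels := by
  refine ⟨isCPTP_measurePrepare hM (isState_maxEnt (by omega)) (isState_complState hm),
    posSemidef_partialTranspose_choi_measurePrepare ?_⟩
  have hm2 : (2 : ℝ) ≤ m := by exact_mod_cast hm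
  have h1 : (0 : ℝ) ≤ (2 * (m : ℝ) * (m + 1))⁻¹ := by positivity
  have h2 : (0 : ℝ) ≤ (2 * (m : ℝ) * (m - 1))⁻¹ :=
    inv_nonneg.mpr (mul_nonneg (by linarith) (by linarith))
  -- Diagonalise the flip. With `N` the partial transpose of `M`, the operator is `(1 + mN) /
  -- (m(m+1))` on the symmetric space and `(1 - mN) / (m(m-1))` on the antisymmetric one, transposes
  -- aside; the projectors `(1 ± flip)/2` supply the factor two.
  have h := ((hadd.transpose.kronecker (posSemidef_one_add_flip m)).smul h1).add
    ((hsub.transpose.kronecker (posSemidef_one_sub_flip m)).smul h2)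
  convert! h using 1
  have hm0 : (m : ℂ) ≠ 0 := by exact_mod_cast (by omega : m ≠ 0)
  have hm1 : (m : ℂ) - 1 ≠ 0 := by
    rw [sub_ne_zero]
    exact_mod_cast (by omega : m ≠ 1)
  have hmp : (m : ℂ) + 1 ≠ 0 := by exact_mod_cast (by omega : m + 1 ≠ 0)
  have hmm : (m : ℂ) ^ 2 - 1 ≠ 0 := by
    rw [show (m : ℂ) ^ 2 - 1 = (m - 1) * (m + 1) by ring]
    exact mul_ne_zero hm1 hmp
  rw [complState, partialTranspose_smul, partialTranspose_sub, partialTranspose_one,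
    partialTranspose_maxEnt]
  ext p q
  simp only [Matrix.add_apply, Matrix.sub_apply, Matrix.smul_apply, Matrix.kroneckerMap_apply,
    Matrix.transpose_apply, smul_eq_mul, Complex.real_smul]
  push_cast
  rw [show (m : ℂ) ^ 2 - 1 = (m - 1) * (m + 1) by ring]
  field_simp
  ring

/-- A separable input has positive partial transpose, so `m M^{T_B} ⪯ 1` caps its success
probability at `1/m`. The output then lies in the separable range of mixtures. -/
theorem measurePrepare_offDiagState_mem_SEPP {m : ℕ} (hm : 2 ≤ m)
    {M : Matrix (α × β) (α × β) ℂ} (hM : IsEffect M)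
    (hsub : (1 + ((-m : ℝ) : ℂ) • partialTranspose M).PosSemidef) :
    measurePrepare M (maxEnt m) (offDiagState m) ∈ OpClass.SEPP.channels := by
  refine ⟨isCPTP_measurePrepare hM (isState_maxEnt (by omega))
    (isState_of_mem_SEP (offDiagState_mem_SEP hm)), fun X hX => ?_⟩
  obtain ⟨htr, hX1, hX2⟩ := SEP_subset_PPTplus hX
  have hm0 : (0 : ℝ) < m := by positivity
  have hpos := Complex.le_def.mp (trace_mul_nonneg hX1 hM.1)
  have hle := trace_mul_nonneg_re hX2 hsub
  rw [Matrix.mul_add, Matrix.mul_one, Matrix.trace_add, trace_partialTranspose, htr,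
    Matrix.mul_smul, Matrix.trace_smul, trace_partialTranspose_mul_partialTranspose,
    smul_eq_mul, Complex.add_re, Complex.re_ofReal_mul, Complex.one_re] at hle
  have hre : (X * M).trace = (((X * M).trace.re : ℝ) : ℂ) :=
    Complex.ext rfl (by simpa using hpos.2.symm)
  have hmem := mixture_mem_SEP hm (t := (X * M).trace.re) hpos.1
    (by rw [le_div_iff₀ hm0]; linarith)
  convert! hmem using 1
  rw [measurePrepare_apply, Matrix.mul_sub, Matrix.mul_one, Matrix.trace_sub, htr, hre]
  ext p q
  simp

theorem measurePrepare_one_mem_channels (O : OpClass) :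
    measurePrepare (1 : Matrix (α × β) (α × β) ℂ) (maxEnt 1) (maxEnt 1) ∈ O.channels := by
  have hE : IsEffect (1 : Matrix (α × β) (α × β) ℂ) :=
    ⟨Matrix.PosSemidef.one, by rw [sub_self]; exact Matrix.PosSemidef.zero⟩
  have hCP := isCPTP_measurePrepare hE (isState_maxEnt le_rfl) (isState_maxEnt le_rfl)
  have hPPT : measurePrepare (1 : Matrix (α × β) (α × β) ℂ) (maxEnt 1) (maxEnt 1) ∈
      OpClass.PPT.channels := by
    refine ⟨hCP, posSemidef_partialTranspose_choi_measurePrepare ?_⟩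
    have hpt : (partialTranspose (maxEnt 1)).PosSemidef := by
      convert! posSemidef_maxEnt 1 using 1
      ext p q
      simp [partialTranspose_apply, maxEnt_apply, Subsingleton.elim _ (0 : Fin 1)]
    rw [partialTranspose_one, sub_self, Matrix.transpose_zero, Matrix.zero_kronecker, add_zero,
      Matrix.transpose_one]
    exact Matrix.PosSemidef.one.kronecker hpt
  cases O with
  | PPT => exact hPPT
  | RainsPreserving => exact channels_PPT_subset_RainsPreserving hPPT
  | PPTplusPreserving => exact channels_PPT_subset_PPTplusPreserving hPPT
  | SEPP =>
    refine ⟨hCP, fun X hX => ?_⟩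
    rw [measurePrepare_apply, sub_self, Matrix.mul_zero, Matrix.trace_zero, zero_smul, add_zero,
      Matrix.mul_one, (isState_of_mem_SEP hX).2, one_smul]
    convert! ketbra_tensorKet_mem_SEP (x := EuclideanSpace.single (0 : Fin 1) (1 : ℂ))
      (y := EuclideanSpace.single (0 : Fin 1) (1 : ℂ)) (by simp) (by simp) using 1
    simp [maxEnt, maxEntKet]

theorem hs_measurePrepare_maxEnt {m : ℕ} (hm : 1 ≤ m) {M ρ : Matrix (α × β) (α × β) ℂ}
    {τ : Matrix (Fin m × Fin m) (Fin m × Fin m) ℂ}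
    (hΛ : IsCPTP (measurePrepare M (maxEnt m) τ)) (hρ : ρ.PosSemidef)
    (hτ : (τ * maxEnt m).trace = 0) :
    hs (measurePrepare M (maxEnt m) τ ρ) (maxEnt m) = (ρ * M).trace.re := by
  rw [hs_eq_of_isHermitian (hΛ.posSemidef hρ).1, measurePrepare_apply, Matrix.add_mul,
    Matrix.smul_mul, Matrix.smul_mul, maxEnt_mul_self hm, Matrix.trace_add, Matrix.trace_smul,
    Matrix.trace_smul, trace_maxEnt hm, hτ]
  simp

end Achievability

/-! ### Passing from the basis `c` to matrix entries. -/

section Coordinates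

open Matrix

variable {n : Type*} [Fintype n] [DecidableEq n]

/-- The matrix of the operator `W` in the orthonormal basis `c`. -/
noncomputable def coords (c : OrthonormalBasis n ℂ (EuclideanSpace ℂ n)) (W : Matrix n n ℂ) :
    Matrix n n ℂ :=
  (basisMatrix c)ᴴ * W * basisMatrix c

theorem coords_singleParty (c : OrthonormalBasis n ℂ (EuclideanSpace ℂ n)) (r : Matrix n n ℂ) :
    coords c (singleParty c r) = r := by
  rw [coords, singleParty_eq, ← Matrix.mul_assoc, ← Matrix.mul_assoc,
    conjTranspose_basisMatrix_mul_self, Matrix.one_mul, Matrix.mul_assoc,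
    conjTranspose_basisMatrix_mul_self, Matrix.mul_one]

theorem singleParty_coords (c : OrthonormalBasis n ℂ (EuclideanSpace ℂ n)) (W : Matrix n n ℂ) :
    singleParty c (coords c W) = W := by
  rw [coords, singleParty_eq, ← Matrix.mul_assoc, ← Matrix.mul_assoc,
    basisMatrix_mul_conjTranspose_self, Matrix.one_mul, Matrix.mul_assoc,
    basisMatrix_mul_conjTranspose_self, Matrix.mul_one]

theorem singleParty_one (c : OrthonormalBasis n ℂ (EuclideanSpace ℂ n)) :
    singleParty c 1 = 1 := by
  rw [singleParty_eq, Matrix.mul_one, basisMatrix_mul_conjTranspose_self]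

theorem singleParty_sub (c : OrthonormalBasis n ℂ (EuclideanSpace ℂ n)) (A B : Matrix n n ℂ) :
    singleParty c (A - B) = singleParty c A - singleParty c B := by
  simp only [singleParty_eq, Matrix.mul_sub, Matrix.sub_mul]

theorem singleParty_smul (c : OrthonormalBasis n ℂ (EuclideanSpace ℂ n)) (t : ℂ)
    (A : Matrix n n ℂ) : singleParty c (t • A) = t • singleParty c A := by
  simp only [singleParty_eq, Matrix.mul_smul, Matrix.smul_mul]

theorem posSemidef_singleParty_iff (c : OrthonormalBasis n ℂ (EuclideanSpace ℂ n))
    {A : Matrix n n ℂ} : (singleParty c A).PosSemidef ↔ A.PosSemidef := by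
  constructor
  · intro h
    rw [← coords_singleParty c A]
    exact h.conjTranspose_mul_mul_same _
  · intro h
    rw [singleParty_eq]
    exact h.mul_mul_conjTranspose_same _

theorem isEffect_singleParty_iff (c : OrthonormalBasis n ℂ (EuclideanSpace ℂ n))
    {A : Matrix n n ℂ} : IsEffect (singleParty c A) ↔ IsEffect A := by
  rw [IsEffect, IsEffect, posSemidef_singleParty_iff]
  nth_rw 1 [← singleParty_one c]
  rw [← singleParty_sub, posSemidef_singleParty_iff]

theorem trace_singleParty_mul_singleParty (c : OrthonormalBasis n ℂ (EuclideanSpace ℂ n))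
    (A B : Matrix n n ℂ) : (singleParty c A * singleParty c B).trace = (A * B).trace := by
  conv_lhs => rw [singleParty_eq c B]
  rw [← Matrix.mul_assoc, Matrix.trace_mul_comm, ← Matrix.mul_assoc, ← Matrix.mul_assoc,
    ← coords, coords_singleParty]

theorem ketbra_basis_eq_singleParty (c : OrthonormalBasis n ℂ (EuclideanSpace ℂ n)) (i : n) :
    ketbra (c i) (c i) = singleParty c (Matrix.single i i 1) := by
  ext x y
  simp [singleParty_eq, ketbra, Matrix.mul_apply, Matrix.single_apply, basisMatrix, ite_and]

theorem dephase_singleParty (c : OrthonormalBasis n ℂ (EuclideanSpace ℂ n)) (A : Matrix n n ℂ) :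
    dephase c (singleParty c A) = singleParty c (Matrix.diagonal A.diag) := by
  have hmul : ∀ A B : Matrix n n ℂ,
      singleParty c A * singleParty c B = singleParty c (A * B) := by
    intro A B
    simp only [singleParty_eq, Matrix.mul_assoc]
    rw [← Matrix.mul_assoc _ (basisMatrix c) (B * _), conjTranspose_basisMatrix_mul_self,
      Matrix.one_mul]
  have hsum : ∀ f : n → Matrix n n ℂ, singleParty c (∑ i, f i) = ∑ i, singleParty c (f i) := by
    intro f
    simp only [singleParty_eq, Matrix.mul_sum, Matrix.sum_mul]
  simp only [dephase, ketbra_basis_eq_singleParty, hmul, ← hsum]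
  congr 1
  ext x y
  simp only [Matrix.sum_apply, Matrix.single_mul_mul_single, Matrix.single_apply, one_mul, mul_one,
    Matrix.diagonal_apply, Matrix.diag_apply]
  by_cases h : x = y
  · subst h
    simp
  · rw [if_neg h]
    exact Finset.sum_eq_zero fun i _ => if_neg fun hi => h (hi.1.symm.trans hi.2)

theorem hs_singleParty {c : OrthonormalBasis n ℂ (EuclideanSpace ℂ n)} {A : Matrix n n ℂ}
    (hA : A.IsHermitian) (B : Matrix n n ℂ) :
    hs (singleParty c A) (singleParty c B) = (A * B).trace.re := by
  rw [hs_eq_of_isHermitian, trace_singleParty_mul_singleParty]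
  rw [singleParty_eq]
  exact Matrix.isHermitian_mul_mul_conjTranspose _ hA

theorem hs_singleParty_ketbra {c : OrthonormalBasis n ℂ (EuclideanSpace ℂ n)} {A : Matrix n n ℂ}
    (hA : A.IsHermitian) (i : n) :
    hs (singleParty c A) (ketbra (c i) (c i)) = (A i i).re := by
  rw [ketbra_basis_eq_singleParty, hs_singleParty hA, Matrix.trace_mul_comm,
    Matrix.trace_single_mul, one_smul]

theorem hs_sum_smul {ι : Type*} (s : Finset ι) (X : Matrix n n ℂ) (w : ι → ℝ)
    (Y : ι → Matrix n n ℂ) : hs X (∑ i ∈ s, w i • Y i) = ∑ i ∈ s, w i * hs X (Y i) := by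
  simp [hs, Matrix.mul_sum, Matrix.trace_sum, Complex.re_sum]

theorem convex_hs_le (X : Matrix n n ℂ) (t : ℝ) : Convex ℝ {Y : Matrix n n ℂ | hs X Y ≤ t} := by
  intro Y hY Z hZ p q hp hq hpq
  have h : hs X (p • Y + q • Z) = p * hs X Y + q * hs X Z := by
    simp [hs, Matrix.mul_add]
  simp only [Set.mem_ofPred_eq] at *
  rw [h]
  calc p * hs X Y + q * hs X Z ≤ p * t + q * t := by gcongr
    _ = t := by rw [← add_mul, hpq, one_mul]

theorem hs_le_of_mem_incoherent {c : OrthonormalBasis n ℂ (EuclideanSpace ℂ n)}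
    {X : Matrix n n ℂ} {t : ℝ} (h : ∀ i, hs X (ketbra (c i) (c i)) ≤ t) {σ : Matrix n n ℂ}
    (hσ : σ ∈ incoherent c) : hs X σ ≤ t :=
  convexHull_min (t := {Y | hs X Y ≤ t}) (by rintro _ ⟨i, rfl⟩; exact h i) (convex_hs_le X t) hσ

/-- A linear functional is bounded on a convex hull as soon as it is bounded on the generators, and
on these it evaluates to the diagonal entries of `A`. -/
theorem singleParty_mem_smul_polar_iff {c : OrthonormalBasis n ℂ (EuclideanSpace ℂ n)} {t : ℝ}
    (ht : 0 < t) {A : Matrix n n ℂ} (hA : A.IsHermitian) :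
    singleParty c A ∈ (1 / t) • polar (incoherent c) ↔ ∀ i, (A i i).re ≤ 1 / t := by
  have hH : (singleParty c A).IsHermitian := by
    rw [singleParty_eq]
    exact Matrix.isHermitian_mul_mul_conjTranspose _ hA
  have hsm : ∀ Y, hs (t • singleParty c A) Y = t * hs (singleParty c A) Y := by
    intro Y
    simp [hs, Matrix.conjTranspose_smul]
  rw [Set.mem_smul_set_iff_inv_smul_mem₀ (one_div_pos.mpr ht).ne', one_div, inv_inv]
  constructor
  · intro h i
    have := h.2 _ (subset_convexHull ℝ _ ⟨i, rfl⟩)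
    rw [hsm, hs_singleParty_ketbra hA] at this
    rwa [← one_div, le_div_iff₀' ht]
  · intro h
    refine ⟨?_, fun Y hY => hs_le_of_mem_incoherent (fun i => ?_) hY⟩
    · rw [Matrix.IsHermitian, Matrix.conjTranspose_smul, hH.eq, star_trivial]
    · rw [hsm, hs_singleParty_ketbra hA, ← le_div_iff₀' ht, one_div]
      exact h i

/-- Effects whose diagonal entries are at most `t`. -/
def diagBoundedEffects (n : Type*) [Fintype n] [DecidableEq n] (t : ℝ) : Set (Matrix n n ℂ) :=
  {A | IsEffect A ∧ ∀ i, (A i i).re ≤ t}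

theorem G_incoherent_singleParty (c : OrthonormalBasis n ℂ (EuclideanSpace ℂ n))
    {r : Matrix n n ℂ} (hr : r.IsHermitian) {t : ℝ} (ht : 0 < t) :
    G t (incoherent c) (singleParty c r) =
      ⨆ A ∈ diagBoundedEffects n (1 / t), (((r * A).trace.re : ℝ) : EReal) := by
  refine le_antisymm (iSup₂_le ?_) (iSup₂_le ?_)
  · rintro W ⟨hW, hp⟩
    obtain ⟨A, rfl⟩ : ∃ A, singleParty c A = W := ⟨_, singleParty_coords c W⟩
    rw [isEffect_singleParty_iff] at hW
    rw [singleParty_mem_smul_polar_iff ht hW.1.1] at hp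
    rw [hs_singleParty hr]
    exact le_iSup₂_of_le A ⟨hW, hp⟩ le_rfl
  · rintro A ⟨hA, hd⟩
    refine le_iSup₂_of_le (singleParty c A) ⟨(isEffect_singleParty_iff c).mpr hA,
      (singleParty_mem_smul_polar_iff ht hA.1.1).mpr hd⟩ ?_
    rw [hs_singleParty hr]

end Coordinates

/-! ### The fidelity of distillation as an optimisation over diagonally bounded effects. -/

section Fidelity

open Matrix

variable {d : ℕ} (a b : OrthonormalBasis (Fin d) ℂ (EuclideanSpace ℂ (Fin d)))
  {r : Matrix (Fin d) (Fin d) ℂ} (O : OpClass) {m : ℕ}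

theorem fidelity_maxCorr_le (hr : IsState r) (hm : 1 ≤ m) :
    fidelity O (maxCorr a b r) m ≤
      ⨆ A ∈ diagBoundedEffects (Fin d) (1 / m), (((r * A).trace.re : ℝ) : EReal) := by
  refine iSup₂_le fun Λ hΛ => ?_
  have hCP := OpClass.isCPTP_of_mem_channels hΛ
  set A := pullback Λ (pairIsometry a b) (maxEnt m) with hA
  have hhs : ∀ X : Matrix (Fin d) (Fin d) ℂ, X.PosSemidef →
      hs (Λ (maxCorr a b X)) (maxEnt m) = (X * A).trace.re := by
    intro X hX
    rw [hs_eq_of_isHermitian (hCP.posSemidef (posSemidef_maxCorr a b hX)).1, hA,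
      trace_mul_pullback, maxCorr_eq]
  refine le_iSup₂_of_le A ⟨isEffect_pullback hCP (conjTranspose_pairIsometry_mul_self a b)
    (isEffect_maxEnt hm), fun i => ?_⟩ (by rw [hhs r hr.1])
  have h1 := hs_maxEnt_le_of_mem_Rains (O.map_mem_Rains hΛ
    (ketbra_tensorKet_mem_SEP (a.norm_eq_one i) (b.norm_eq_one i)))
  have h2 : ketbra (tensorKet (a i) (b i)) (tensorKet (a i) (b i)) =
      maxCorr a b (Matrix.single i i 1) := by
    simp only [maxCorr, Matrix.single_apply, ite_smul, one_smul, zero_smul, ite_and]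
    simp
  have h3 : (Matrix.single i i (1 : ℂ)).PosSemidef := by
    rw [← Matrix.diagonal_single]
    exact Matrix.PosSemidef.diagonal (Pi.single_nonneg.mpr zero_le_one)
  rw [h2, hhs _ h3, Matrix.trace_single_mul, one_smul] at h1
  exact h1

theorem le_fidelity_maxCorr (hr : IsState r) (hm : 1 ≤ m) :
    ⨆ A ∈ diagBoundedEffects (Fin d) (1 / m), (((r * A).trace.re : ℝ) : EReal) ≤
      fidelity O (maxCorr a b r) m := by
  refine iSup₂_le ?_
  rintro A ⟨hA, hd⟩
  have hρ := posSemidef_maxCorr a b hr.1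
  -- For `m = 1` the normalisations of both failure states degenerate; the constant channel has
  -- fidelity one there.
  obtain rfl | hm2 : m = 1 ∨ 2 ≤ m := by omega
  · refine le_iSup₂_of_le _ (measurePrepare_one_mem_channels O) ?_
    have h := trace_mul_nonneg_re hr.1 hA.2
    rw [Matrix.mul_sub, Matrix.mul_one, Matrix.trace_sub, hr.2, Complex.sub_re,
      Complex.one_re] at h
    have hCP := OpClass.isCPTP_of_mem_channels
      (measurePrepare_one_mem_channels (α := Fin d) (β := Fin d) O)
    rw [hs_eq_of_isHermitian (hCP.posSemidef hρ).1, measurePrepare_apply, sub_self,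
      Matrix.mul_zero, Matrix.trace_zero, zero_smul, add_zero, Matrix.mul_one, trace_maxCorr, hr.2,
      one_smul, maxEnt_mul_self le_rfl, trace_maxEnt le_rfl, Complex.one_re]
    exact_mod_cast (by linarith : (r * A).trace.re ≤ 1)
  · have hm0 : (0 : ℝ) < m := by positivity
    have hnorm : ∀ i j, (m : ℝ) * ‖A i j‖ ≤ 1 := by
      intro i j
      rw [← le_div_iff₀' hm0]
      exact norm_apply_le_of_diag_le hA.1 (by positivity) hd i j
    have hM := isEffect_maxCorr a b hA
    have hadd := posSemidef_one_add_smul_partialTranspose_maxCorr a b hA.1.1 (s := m)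
      (by simpa using hnorm)
    have hsub := posSemidef_one_add_smul_partialTranspose_maxCorr a b hA.1.1 (s := -m)
      (by simpa using hnorm)
    have hPPT := measurePrepare_complState_mem_PPT hm2 hM hadd hsub
    have hSEPP := measurePrepare_offDiagState_mem_SEPP hm2 hM hsub
    have h1 := hs_measurePrepare_maxEnt hm hPPT.1 hρ (trace_complState_mul_maxEnt hm)
    have h2 := hs_measurePrepare_maxEnt hm hSEPP.1 hρ (trace_offDiagState_mul_maxEnt m)
    rw [trace_maxCorr_mul_maxCorr] at h1 h2
    cases O with
    | PPT => exact le_iSup₂_of_le _ hPPT (by rw [h1])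
    | RainsPreserving =>
      exact le_iSup₂_of_le _ (channels_PPT_subset_RainsPreserving hPPT) (by rw [h1])
    | PPTplusPreserving =>
      exact le_iSup₂_of_le _ (channels_PPT_subset_PPTplusPreserving hPPT) (by rw [h1])
    | SEPP => exact le_iSup₂_of_le _ hSEPP (by rw [h2])

theorem fidelity_maxCorr (hr : IsState r) (hm : 1 ≤ m) :
    fidelity O (maxCorr a b r) m =
      ⨆ A ∈ diagBoundedEffects (Fin d) (1 / m), (((r * A).trace.re : ℝ) : EReal) :=
  (fidelity_maxCorr_le a b O hr hm).antisymm (le_fidelity_maxCorr a b O hr hm)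

end Fidelity

/-! ### Compactness, minimax and dephasing for effects. -/

section Effects

open Matrix

variable {n : Type*} [Fintype n] [DecidableEq n]

theorem isEffect_one : IsEffect (1 : Matrix n n ℂ) :=
  ⟨Matrix.PosSemidef.one, by rw [sub_self]; exact Matrix.PosSemidef.zero⟩

theorem isEffect_zero : IsEffect (0 : Matrix n n ℂ) :=
  ⟨Matrix.PosSemidef.zero, by rw [sub_zero]; exact Matrix.PosSemidef.one⟩

theorem IsEffect.apply_self_re_nonneg {A : Matrix n n ℂ} (hA : IsEffect A) (i : n) :
    0 ≤ (A i i).re :=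
  (Complex.le_def.mp (hA.1.diag_nonneg (i := i))).1

theorem IsEffect.apply_self_re_le_one {A : Matrix n n ℂ} (hA : IsEffect A) (i : n) :
    (A i i).re ≤ 1 := by
  have h := (Complex.le_def.mp (hA.2.diag_nonneg (i := i))).1
  simp only [Matrix.sub_apply, Matrix.one_apply_eq, Complex.sub_re, Complex.one_re,
    Complex.zero_re] at h
  linarith

theorem isClosed_setOf_posSemidef : IsClosed {A : Matrix n n ℂ | A.PosSemidef} := by
  simp only [Matrix.posSemidef_iff_dotProduct_mulVec, Set.ofPred_and, Set.ofPred_forall]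
  refine IsClosed.inter (isClosed_eq (by fun_prop) continuous_id) (isClosed_iInter fun x => ?_)
  refine isClosed_le continuous_const ?_
  simp only [dotProduct, Matrix.mulVec]
  fun_prop

theorem isCompact_setOf_isEffect : IsCompact {A : Matrix n n ℂ | IsEffect A} := by
  have hK : IsCompact (Set.univ.pi fun _ : n => Set.univ.pi fun _ : n =>
      Metric.closedBall (0 : ℂ) 1) :=
    isCompact_univ_pi fun _ => isCompact_univ_pi fun _ => isCompact_closedBall 0 1
  refine hK.of_isClosed_subset ?_ fun A hA i _ j _ => ?_
  · exact isClosed_setOf_posSemidef.inter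
      (isClosed_setOf_posSemidef.preimage (continuous_const.sub continuous_id))
  · rw [mem_closedBall_zero_iff]
    exact norm_apply_le_of_diag_le hA.1 zero_le_one hA.apply_self_re_le_one i j

theorem convex_setOf_isEffect : Convex ℝ {A : Matrix n n ℂ | IsEffect A} := by
  intro A hA B hB s t hs ht hst
  refine ⟨(hA.1.smul hs).add (hB.1.smul ht), ?_⟩
  have h : (1 : Matrix n n ℂ) - (s • A + t • B) = s • (1 - A) + t • (1 - B) := by
    conv_lhs => rw [← one_smul ℝ (1 : Matrix n n ℂ), ← hst]
    module
  rw [h]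
  exact (hA.2.smul hs).add (hB.2.smul ht)

theorem continuous_trace_mul_re (r : Matrix n n ℂ) :
    Continuous fun A : Matrix n n ℂ => (r * A).trace.re := by
  simp only [Matrix.trace, Matrix.diag_apply, Matrix.mul_apply]
  fun_prop

/-- Effects that accept `r` with probability at least `t`. -/
def acceptingEffects (r : Matrix n n ℂ) (t : ℝ) : Set (Matrix n n ℂ) :=
  {A | IsEffect A ∧ t ≤ (r * A).trace.re}

theorem isCompact_acceptingEffects (r : Matrix n n ℂ) (t : ℝ) :
    IsCompact (acceptingEffects r t) :=
  isCompact_setOf_isEffect.inter_right (isClosed_le continuous_const (continuous_trace_mul_re r))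

theorem convex_acceptingEffects (r : Matrix n n ℂ) (t : ℝ) :
    Convex ℝ (acceptingEffects r t) := by
  refine convex_setOf_isEffect.inter (t := {A | t ≤ (r * A).trace.re}) ?_
  intro A hA B hB p q hp hq hpq
  simp only [Set.mem_ofPred_eq] at *
  rw [Matrix.mul_add, Matrix.mul_smul, Matrix.mul_smul, Matrix.trace_add, Matrix.trace_smul,
    Matrix.trace_smul, Complex.add_re, Complex.smul_re, Complex.smul_re, smul_eq_mul, smul_eq_mul]
  calc t = p * t + q * t := by rw [← add_mul, hpq, one_mul]
    _ ≤ _ := by gcongr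

theorem one_mem_acceptingEffects {r : Matrix n n ℂ} (hr : IsState r) {t : ℝ} (ht : t ≤ 1) :
    1 ∈ acceptingEffects r t :=
  ⟨isEffect_one, by rw [Matrix.mul_one, hr.2, Complex.one_re]; exact ht⟩

theorem isCompact_diagBoundedEffects (t : ℝ) : IsCompact (diagBoundedEffects n t) := by
  have h : diagBoundedEffects n t = {A | IsEffect A} ∩ ⋂ i, {A | (A i i).re ≤ t} := by
    ext A
    simp [diagBoundedEffects]
  rw [h]
  exact isCompact_setOf_isEffect.inter_right
    (isClosed_iInter fun i => isClosed_le (by fun_prop) continuous_const)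

/-- The minimax theorem for the diagonal entries of accepting effects. -/
theorem exists_saddlePoint_acceptingEffects [Nonempty n] {r : Matrix n n ℂ} (hr : IsState r)
    {t : ℝ} (ht : t ≤ 1) :
    ∃ A ∈ acceptingEffects r t, ∃ p ∈ stdSimplex ℝ n, ∃ w : ℝ, 0 ≤ w ∧ w ≤ 1 ∧
      (∀ i, (A i i).re ≤ w) ∧ (∑ i, p i * (A i i).re = w) ∧
      ∀ B ∈ acceptingEffects r t, w ≤ ∑ i, p i * (B i i).re := by
  obtain ⟨A, hA, p, hp, hs⟩ := Sion.exists_isSaddlePointOn (X := acceptingEffects r t)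
    (Y := stdSimplex ℝ n) (f := fun A p => ∑ i, p i * (A i i).re)
    ⟨1, one_mem_acceptingEffects hr ht⟩ (convex_acceptingEffects r t)
    (isCompact_acceptingEffects r t)
    (fun p _ => (Continuous.lowerSemicontinuous (by fun_prop)).lowerSemicontinuousOn _)
    (fun p _ => by
      refine ConvexOn.quasiconvexOn ⟨convex_acceptingEffects r t, ?_⟩
      intro A _ B _ s u _ _ _
      refine le_of_eq ?_
      simp only [Matrix.add_apply, Matrix.smul_apply, Complex.add_re, Complex.smul_re, smul_eq_mul,
        Finset.mul_sum, ← Finset.sum_add_distrib]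
      exact Finset.sum_congr rfl fun _ _ => by ring)
    (convex_stdSimplex ℝ n) ⟨_, single_mem_stdSimplex ℝ (Classical.arbitrary n)⟩
    (isCompact_stdSimplex ℝ n)
    (fun A _ => (Continuous.upperSemicontinuous (by fun_prop)).upperSemicontinuousOn _)
    (fun A _ => by
      refine ConcaveOn.quasiconcaveOn ⟨convex_stdSimplex ℝ n, ?_⟩
      intro p _ q _ s u _ _ _
      refine le_of_eq ?_
      simp only [Pi.add_apply, Pi.smul_apply, smul_eq_mul, Finset.mul_sum,
        ← Finset.sum_add_distrib]
      exact Finset.sum_congr rfl fun _ _ => by ring)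
  refine ⟨A, hA, p, hp, _, ?_, ?_, fun i => ?_, rfl, fun B hB => hs B hB p hp⟩
  · exact Finset.sum_nonneg fun i _ => mul_nonneg (hp.1 i) (hA.1.apply_self_re_nonneg i)
  · rw [← hp.2]
    exact Finset.sum_le_sum fun i _ =>
      mul_le_of_le_one_right (hp.1 i) (hA.1.apply_self_re_le_one i)
  -- Testing the saddle point against vertices of the simplex bounds each diagonal entry by the
  -- value.
  · have := hs A hA (Pi.single i 1) (single_mem_stdSimplex ℝ i)
    simpa [Pi.single_apply] using this

theorem sum_mul_le_of_mem_stdSimplex {p : n → ℝ} (hp : p ∈ stdSimplex ℝ n) {x : n → ℝ} {t : ℝ}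
    (h : ∀ i, x i ≤ t) : ∑ i, p i * x i ≤ t := by
  calc ∑ i, p i * x i ≤ ∑ i, p i * t :=
        Finset.sum_le_sum fun i _ => mul_le_mul_of_nonneg_left (h i) (hp.1 i)
    _ = t := by rw [← Finset.sum_mul, hp.2, one_mul]

theorem opNorm_singleParty_diagonal (c : OrthonormalBasis n ℂ (EuclideanSpace ℂ n)) (v : n → ℂ) :
    opNorm (singleParty c (Matrix.diagonal v)) = ‖v‖ := by
  open scoped Matrix.Norms.L2Operator in
  have hU : basisMatrix c ∈ unitary (Matrix n n ℂ) :=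
    ⟨conjTranspose_basisMatrix_mul_self c, basisMatrix_mul_conjTranspose_self c⟩
  rw [opNorm, Matrix.l2_opNorm_toEuclideanCLM, singleParty_eq, ← Matrix.star_eq_conjTranspose,
    CStarRing.norm_mul_mem_unitary _ (Unitary.star_mem hU), CStarRing.norm_mem_unitary_mul _ hU,
    Matrix.l2_opNorm_diagonal]

theorem opNorm_dephase_singleParty_le_iff (c : OrthonormalBasis n ℂ (EuclideanSpace ℂ n))
    {A : Matrix n n ℂ} (hA : A.PosSemidef) {t : ℝ} (ht : 0 ≤ t) :
    opNorm (dephase c (singleParty c A)) ≤ t ↔ ∀ i, (A i i).re ≤ t := by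
  rw [dephase_singleParty, opNorm_singleParty_diagonal, pi_norm_le_iff_of_nonneg ht]
  refine forall_congr' fun i => ?_
  rw [Matrix.diag_apply, ← Complex.re_eq_norm.mpr hA.diag_nonneg]

theorem posSemidef_smul_one_sub_dephase_iff (c : OrthonormalBasis n ℂ (EuclideanSpace ℂ n))
    {A : Matrix n n ℂ} (hA : A.PosSemidef) {t : ℝ} :
    ((t : ℂ) • (1 : Matrix n n ℂ) - dephase c (singleParty c A)).PosSemidef ↔
      ∀ i, (A i i).re ≤ t := by
  rw [dephase_singleParty, ← singleParty_one c, ← singleParty_smul, ← singleParty_sub,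
    posSemidef_singleParty_iff, Matrix.smul_one_eq_diagonal, Matrix.diagonal_sub,
    Matrix.posSemidef_diagonal_iff]
  refine forall_congr' fun i => ?_
  have h := (Complex.le_def.mp (hA.diag_nonneg (i := i))).2
  rw [Matrix.diag_apply, sub_nonneg, Complex.le_def]
  simpa using fun _ => h.symm

end Effects

/-! ### Extended logarithms and the rounded logarithm. -/

section Logarithm

theorem elog_coe_of_pos {x : ℝ} (hx : 0 < x) : elog (x : EReal) = ((Real.logb 2 x : ℝ) : EReal) := by
  rw [elog, if_neg (by exact_mod_cast hx.not_ge), if_neg (EReal.coe_ne_top x), EReal.toReal_coe]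

theorem elog_of_nonpos {x : EReal} (hx : x ≤ 0) : elog x = ⊥ := if_pos hx

theorem elog_coe_mono : Monotone fun x : ℝ => elog (x : EReal) := by
  intro x y hxy
  by_cases hx : 0 < x
  · simp only [elog_coe_of_pos hx, elog_coe_of_pos (hx.trans_le hxy)]
    exact_mod_cast Real.logb_le_logb_of_le one_lt_two hx hxy
  · simp only [elog_of_nonpos (show (x : EReal) ≤ 0 by exact_mod_cast not_lt.mp hx), bot_le]

theorem elog_mono : Monotone elog := by
  intro x y hxy
  induction x with
  | bot => rw [elog_of_nonpos bot_le]; exact bot_le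
  | top => rw [top_le_iff.mp hxy]
  | coe x =>
    induction y with
    | bot => exact absurd hxy (by simp)
    | top =>
      rw [elog.eq_1 ⊤, if_neg (by simp), if_pos rfl]
      exact le_top
    | coe y => exact elog_coe_mono (EReal.coe_le_coe_iff.mp hxy)

theorem iSup_elog_natCast_eq_logFloor {w : ℝ} (h0 : 0 ≤ w) (h1 : w ≤ 1) :
    ⨆ m ∈ {m : ℕ | 1 ≤ m ∧ w ≤ 1 / m}, elog ((m : ℝ) : EReal) =
      logFloor (-elog (w : EReal)) := by
  rcases h0.eq_or_lt with rfl | hw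
  -- If `w = 0`, every `m ≥ 1` qualifies and both sides are `⊤`.
  · rw [elog_of_nonpos EReal.coe_zero.le, EReal.neg_bot, logFloor, if_neg top_ne_bot, if_pos rfl,
      EReal.eq_top_iff_forall_lt]
    intro y
    obtain ⟨m, hm⟩ := exists_nat_gt ((2 : ℝ) ^ y)
    have hm0 : (0 : ℝ) < m := (Real.rpow_pos_of_pos two_pos y).trans hm
    have hm1 : 1 ≤ m := by exact_mod_cast hm0
    refine lt_of_lt_of_le ?_ (le_iSup₂_of_le m ⟨hm1, by positivity⟩ le_rfl)
    rw [elog_coe_of_pos hm0]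
    exact_mod_cast (Real.lt_logb_iff_rpow_lt one_lt_two hm0).mpr hm
  · have hpow : (2 : ℝ) ^ (-Real.logb 2 w) = w⁻¹ := by
      rw [Real.rpow_neg two_pos.le, Real.rpow_logb two_pos (by norm_num) hw]
    rw [elog_coe_of_pos hw, ← EReal.coe_neg, logFloor, if_neg (EReal.coe_ne_bot _),
      if_neg (EReal.coe_ne_top _), EReal.toReal_coe, hpow,
      ← natCast_floor_eq_intCast_floor (inv_nonneg.mpr h0)]
    have hmem : ∀ m : ℕ, 1 ≤ m → (w ≤ 1 / m ↔ m ≤ ⌊w⁻¹⌋₊) := by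
      intro m hm
      rw [Nat.le_floor_iff (inv_nonneg.mpr h0), one_div,
        le_inv_comm₀ hw (by exact_mod_cast hm)]
    have hfloor : 1 ≤ ⌊w⁻¹⌋₊ := Nat.one_le_floor_iff _ |>.mpr ((one_le_inv₀ hw).mpr h1)
    refine le_antisymm (iSup₂_le ?_)
      (le_iSup₂_of_le ⌊w⁻¹⌋₊ ⟨hfloor, (hmem _ hfloor).mpr le_rfl⟩ le_rfl)
    rintro m ⟨hm, hmw⟩
    exact elog_coe_mono (by exact_mod_cast (hmem m hm).mp hmw)

end Logarithm

/-! ### The one-shot distillable entanglement. -/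

section OneShot

open Matrix

variable {d : ℕ} (a b c : OrthonormalBasis (Fin d) ℂ (EuclideanSpace ℂ (Fin d)))
  {r : Matrix (Fin d) (Fin d) ℂ}

/-- Compactness of the feasible effects makes the supremum attained, so reaching the threshold `1 -
ε` in the limit already means reaching it with one effect. -/
theorem le_iSup_diagBoundedEffects_iff {ε t : ℝ} (ht : 0 ≤ t) :
    ((1 - ε : ℝ) : EReal) ≤
        ⨆ A ∈ diagBoundedEffects (Fin d) t, (((r * A).trace.re : ℝ) : EReal) ↔
      ∃ A ∈ acceptingEffects r (1 - ε), ∀ i, (A i i).re ≤ t := by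
  constructor
  · intro h
    obtain ⟨A, hA, hmax⟩ := (isCompact_diagBoundedEffects (n := Fin d) t).exists_isMaxOn
      ⟨0, isEffect_zero, fun i => by simpa using ht⟩ (continuous_trace_mul_re r).continuousOn
    refine ⟨A, ⟨hA.1, ?_⟩, hA.2⟩
    have := h.trans (iSup₂_le fun B hB => EReal.coe_le_coe_iff.mpr (hmax hB))
    exact_mod_cast this
  · rintro ⟨A, ⟨hA, hacc⟩, hd⟩
    exact le_iSup₂_of_le A ⟨hA, hd⟩ (EReal.coe_le_coe_iff.mpr hacc)

theorem distillable_maxCorr (O : OpClass) (hr : IsState r) {ε w : ℝ} (h0 : 0 ≤ w) (h1 : w ≤ 1)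
    (hw : ∀ t, (∃ A ∈ acceptingEffects r (1 - ε), ∀ i, (A i i).re ≤ t) ↔ w ≤ t) :
    distillable O ε (maxCorr a b r) = logFloor (-elog (w : EReal)) := by
  have hset : {m : ℕ | 1 ≤ m ∧ ((1 - ε : ℝ) : EReal) ≤ fidelity O (maxCorr a b r) m} =
      {m : ℕ | 1 ≤ m ∧ w ≤ 1 / m} := by
    ext m
    refine and_congr_right fun hm => ?_
    rw [fidelity_maxCorr a b O hr hm, le_iSup_diagBoundedEffects_iff (by positivity), hw]
  rw [distillable, hset, iSup_elog_natCast_eq_logFloor h0 h1]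

theorem DH_singleParty (ε : ℝ) (σ : Matrix (Fin d) (Fin d) ℂ) :
    DH ε (singleParty c r) σ =
      -elog (⨅ A ∈ acceptingEffects r (1 - ε), ((hs (singleParty c A) σ : ℝ) : EReal)) := by
  rw [DH]
  congr 2
  have key : ∀ A : Matrix (Fin d) (Fin d) ℂ,
      (IsEffect (singleParty c A) ∧ 1 - hs (singleParty c A) (singleParty c r) ≤ ε) ↔
        A ∈ acceptingEffects r (1 - ε) := by
    intro A
    rw [isEffect_singleParty_iff]
    refine and_congr_right fun hA => ?_
    rw [hs_singleParty hA.1.1, Matrix.trace_mul_comm, sub_le_comm]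
  refine le_antisymm (le_iInf₂ fun A hA => iInf₂_le_of_le _ ((key A).mpr hA) le_rfl)
    (le_iInf₂ fun M hM => ?_)
  obtain ⟨A, rfl⟩ : ∃ A, singleParty c A = M := ⟨_, singleParty_coords c M⟩
  exact iInf₂_le_of_le A ((key A).mp hM) le_rfl

/-- The saddle point supplies both optimisers: its probability vector is the spectrum of an optimal
incoherent state, and its effect is a test that no incoherent state passes with probability above
`w`. -/
theorem exists_oneShot_value (hr : IsState r) {ε : ℝ} (h0 : 0 ≤ ε) :
    ∃ w : ℝ, 0 ≤ w ∧ w ≤ 1 ∧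
      (∀ t, (∃ A ∈ acceptingEffects r (1 - ε), ∀ i, (A i i).re ≤ t) ↔ w ≤ t) ∧
      IsLeast (DH ε (singleParty c r) '' incoherent c) (-elog (w : EReal)) := by
  -- A state has trace one, which excludes dimension zero.
  have : Nonempty (Fin d) := by
    by_contra hd
    rw [not_nonempty_iff] at hd
    have h := hr.2
    rw [Matrix.trace, Finset.univ_eq_empty, Finset.sum_empty] at h
    exact zero_ne_one h
  obtain ⟨A, hA, p, hp, w, hw0, hw1, hAw, hAp, hB⟩ :=
    exists_saddlePoint_acceptingEffects hr (t := 1 - ε) (by linarith)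
  refine ⟨w, hw0, hw1, fun t => ⟨?_, fun ht => ⟨A, hA, fun i => (hAw i).trans ht⟩⟩, ?_, ?_⟩
  · rintro ⟨B, hBm, hBt⟩
    exact (hB B hBm).trans (sum_mul_le_of_mem_stdSimplex hp hBt)
  · refine ⟨∑ i, p i • ketbra (c i) (c i), ?_, ?_⟩
    · exact (convex_convexHull ℝ _).sum_mem (fun i _ => hp.1 i) hp.2
        fun i _ => subset_convexHull ℝ _ ⟨i, rfl⟩
    · have hval : ∀ B : Matrix (Fin d) (Fin d) ℂ, B.IsHermitian →
          hs (singleParty c B) (∑ i, p i • ketbra (c i) (c i)) = ∑ i, p i * (B i i).re := by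
        intro B hBH
        rw [hs_sum_smul]
        simp only [hs_singleParty_ketbra hBH]
      rw [DH_singleParty c]
      congr 2
      refine le_antisymm (iInf₂_le_of_le A hA ?_) (le_iInf₂ fun B hBm => ?_)
      · rw [hval A hA.1.1.1, hAp]
      · rw [hval B hBm.1.1.1]
        exact EReal.coe_le_coe_iff.mpr (hB B hBm)
  · rintro _ ⟨σ, hσ, rfl⟩
    rw [DH_singleParty c, EReal.neg_le_neg_iff]
    refine elog_mono (iInf₂_le_of_le A hA (EReal.coe_le_coe_iff.mpr ?_))
    exact hs_le_of_mem_incoherent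
      (fun i => by rw [hs_singleParty_ketbra hA.1.1.1]; exact hAw i) hσ

/-- Dephasing keeps only the diagonal in the basis `c`, whose entries are nonnegative for an effect,
so the operator norm is the largest of them. -/
theorem isLeast_opNorm_dephase (hr : r.IsHermitian) {ε w : ℝ} (h0 : 0 ≤ w)
    (hw : ∀ t, (∃ A ∈ acceptingEffects r (1 - ε), ∀ i, (A i i).re ≤ t) ↔ w ≤ t) :
    IsLeast {t : ℝ | ∃ W : Matrix (Fin d) (Fin d) ℂ,
      IsEffect W ∧ 1 - ε ≤ hs (singleParty c r) W ∧ t = opNorm (dephase c W)} w := by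
  have hlow : ∀ A ∈ acceptingEffects r (1 - ε), w ≤ opNorm (dephase c (singleParty c A)) :=
    fun A hA => (hw _).mp
      ⟨A, hA, (opNorm_dephase_singleParty_le_iff c hA.1.1 (norm_nonneg _)).mp le_rfl⟩
  constructor
  · obtain ⟨A, hA, hAw⟩ := (hw w).mpr le_rfl
    refine ⟨singleParty c A, (isEffect_singleParty_iff c).mpr hA.1, ?_, (hlow A hA).antisymm
      ((opNorm_dephase_singleParty_le_iff c hA.1.1 h0).mpr hAw)⟩
    rw [hs_singleParty hr]
    exact hA.2
  · rintro t ⟨W, hW, hacc, rfl⟩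
    obtain ⟨A, rfl⟩ : ∃ A, singleParty c A = W := ⟨_, singleParty_coords c W⟩
    rw [hs_singleParty hr] at hacc
    exact hlow A ⟨(isEffect_singleParty_iff c).mp hW, hacc⟩

theorem isLeast_smul_one_sub_dephase (hr : r.IsHermitian) {ε w : ℝ}
    (hw : ∀ t, (∃ A ∈ acceptingEffects r (1 - ε), ∀ i, (A i i).re ≤ t) ↔ w ≤ t) :
    IsLeast {t : ℝ | ∃ W : Matrix (Fin d) (Fin d) ℂ,
      IsEffect W ∧ 1 - ε ≤ hs (singleParty c r) W ∧
        ((t : ℂ) • (1 : Matrix (Fin d) (Fin d) ℂ) - dephase c W).PosSemidef} w := by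
  constructor
  · obtain ⟨A, hA, hAw⟩ := (hw w).mpr le_rfl
    refine ⟨singleParty c A, (isEffect_singleParty_iff c).mpr hA.1, ?_,
      (posSemidef_smul_one_sub_dephase_iff c hA.1.1).mpr hAw⟩
    rw [hs_singleParty hr]
    exact hA.2
  · rintro t ⟨W, hW, hacc, hpos⟩
    obtain ⟨A, rfl⟩ : ∃ A, singleParty c A = W := ⟨_, singleParty_coords c W⟩
    rw [hs_singleParty hr] at hacc
    have hA := (isEffect_singleParty_iff c).mp hW
    exact (hw t).mp ⟨A, ⟨hA, hacc⟩, (posSemidef_smul_one_sub_dephase_iff c hA.1).mp hpos⟩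

end OneShot
end Distill

theorem mainTheorem5 {d : ℕ}
    (a b c : OrthonormalBasis (Fin d) ℂ (EuclideanSpace ℂ (Fin d)))
    (r : Matrix (Fin d) (Fin d) ℂ) (hρ : Distill.IsState (Distill.maxCorr a b r))
    (O : Distill.OpClass) :
    (∀ m : ℕ, 1 ≤ m →
      Distill.fidelity O (Distill.maxCorr a b r) m =
        Distill.G (m : ℝ) (Distill.incoherent c) (Distill.singleParty c r)) ∧
    ∀ ε : ℝ, 0 ≤ ε → ε ≤ 1 →
      ∃ (v : EReal) (w : ℝ),
        IsLeast (Distill.DH ε (Distill.singleParty c r) '' Distill.incoherent c) v ∧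
        IsLeast {t : ℝ | ∃ W : Matrix (Fin d) (Fin d) ℂ,
          Distill.IsEffect W ∧ 1 - ε ≤ Distill.hs (Distill.singleParty c r) W ∧
            t = Distill.opNorm (Distill.dephase c W)} w ∧
        IsLeast {t : ℝ | ∃ W : Matrix (Fin d) (Fin d) ℂ,
          Distill.IsEffect W ∧ 1 - ε ≤ Distill.hs (Distill.singleParty c r) W ∧
            ((t : ℂ) • (1 : Matrix (Fin d) (Fin d) ℂ) - Distill.dephase c W).PosSemidef} w ∧
        Distill.distillable O ε (Distill.maxCorr a b r) = Distill.logFloor v ∧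
        Distill.distillable O ε (Distill.maxCorr a b r) =
          Distill.logFloor (-Distill.elog ((w : ℝ) : EReal)) := by
  have hr := hρ.of_maxCorr
  refine ⟨fun m hm => ?_, fun ε h0 _ => ?_⟩
  · rw [Distill.fidelity_maxCorr a b O hr hm,
      Distill.G_incoherent_singleParty c hr.1.1 (by exact_mod_cast hm)]
  · obtain ⟨w, hw0, hw1, hw, hleast⟩ := Distill.exists_oneShot_value c hr h0
    have hdist := Distill.distillable_maxCorr a b O hr hw0 hw1 hw
    exact ⟨_, w, hleast, Distill.isLeast_opNorm_dephase c hr.1.1 hw0 hw,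
      Distill.isLeast_smul_one_sub_dephase c hr.1.1 hw, hdist, hdist⟩
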